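/- Let $\mathcal X\subset\mathbb R^d$ be compact, $\mathcal H_K$ the reproducing kernel Hilbert space of a Mercer (continuous, symmetric, positive semidefinite) kernel $K$ on $\mathcal X$, and $\rho$ a probability measure on $\mathcal X\times[-1,1]$ such that $\|K(x,\cdot)\|_K\le 1$ for $\rho$-almost every $(x,y)$. Let $\ell:\mathbb R\to[0,\infty)$ be convex, $L$-Lipschitz with $L>0$, and $H$-smooth (differentiable with $H$-Lipschitz derivative), and write $\mathcal E^\ell(f)=\int \ell(y f(x))\,d\rho(x,y)$. Let $b>0$ and $a\ge 2.25\,L$. Given samples $(x_1,y_1),\dots,(x_T,y_T)$, $T\ge 1$, the PiSTOL algorithm starts with $g_0=0\in\mathcal H_K$, $\alpha_0=aL$, and for $t=1,\dots,T$ sets $$f_t=\frac{b}{\alpha_{t-1}}\exp\!\Big(\frac{\|g_{t-1}\|_K^2}{2\alpha_{t-1}}\Big)g_{t-1},\qquad s_t\in\partial \ell_t(f_t(x_t)),\quad \ell_t(u)=\ell(y_tu),$$ $$g_t=g_{t-1}-s_tK(x_t,\cdot),\qquad \alpha_t=\alpha_{t-1}+a|s_t|\,\|K(x_t,\cdot)\|_K;$$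 it returns $\bar f_T=\frac1T\sum_{t=1}^T f_t$. There are a universal $p\in\mathbb N$ and a constant $C>0$ depending only on $a,b,L,H$ such that, whenever the samples are IID from $\rho$, $\mathcal E^\ell(\bar f_T)$ is integrable and $$\mathbb E[\mathcal E^\ell(\bar f_T)]\le \inf_{h\in\mathcal H_K}\left\{\mathcal E^\ell(h)+C\log^p(1+T)\left(\max\left\{\|h\|_K^{4/3}T^{-2/3},\ \|h\|_KT^{-3/4}\big(T\mathcal E^\ell(h)+1\big)^{1/4}\right\}+\frac1T\right)\right\}.$$ The infimum is over all of $\mathcal H_K$, with no restriction to a norm ball. In the usual notation, the excess is $\tilde{\mathcal O}(\max\{\cdot,\cdot\}+1/T)$. -/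

import Mathlib

open MeasureTheory ProbabilityTheory
open scoped NNReal

universe u v

noncomputable section

/-- An `L`-Lipschitz and `H`-smooth convex loss `ℓ : ℝ → [0, ∞)`. -/
structure IsSmoothLoss (L H : ℝ≥0) (ℓ : ℝ → ℝ) : Prop where
  nonneg : ∀ u, 0 ≤ ℓ u
  convex : ConvexOn ℝ Set.univ ℓ
  lipschitz : LipschitzWith L ℓ
  differentiable : Differentiable ℝ ℓ
  lipschitz_deriv : LipschitzWith H (deriv ℓ)

/-- `s` belongs to the subdifferential of `φ : ℝ → ℝ` at the point `v`. -/
def IsSubgradient (φ : ℝ → ℝ) (v s : ℝ) : Prop :=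
  ∀ u : ℝ, (u - v) * s ≤ φ u - φ v

/-- The `ℓ`-risk of `f`: the integral of `ℓ (y * f x)` with respect to the law `ρ` of the labelled
points `(x, y)`, with labels in `[-1, 1]`. -/
def lossRisk {X : Type*} [MeasurableSpace X] (ρ : Measure (X × Set.Icc (-1 : ℝ) 1))
    (ℓ : ℝ → ℝ) (f : X → ℝ) : ℝ :=
  ∫ z, ℓ ((z.2 : ℝ) * f z.1) ∂ρ

section RKHS

variable {X : Type*} (𝓗 : Type*) [NormedAddCommGroup 𝓗] [InnerProductSpace ℝ 𝓗]
  [CompleteSpace 𝓗] [RKHS ℝ 𝓗 X ℝ]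

/-- The real-valued reproducing kernel `K` of a Hilbert space of real functions on `X`. -/
def reproKernel (x x' : X) : ℝ := RKHS.kernel 𝓗 x x' 1

/-- The element `K(x, ·)` of the Hilbert space. -/
def kernelSection (x : X) : 𝓗 := RKHS.kerFun 𝓗 x 1

/-- The reproducing property. -/
theorem inner_kernelSection (x : X) (f : 𝓗) : inner ℝ (kernelSection 𝓗 x) f = f x := by
  simp [kernelSection]

/-- `kernelSection 𝓗 x'` is the function `K(·, x')`. -/
theorem kernelSection_apply (x x' : X) : kernelSection 𝓗 x' x = reproKernel 𝓗 x x' :=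
  RKHS.kerFun_apply 𝓗 x' 1 x

namespace PiSTOL

/-! The algorithm on the inputs `x 0, x 1, …`, given the subgradients `s 0, s 1, …` that it
receives. The rounds are numbered from `0`: the prediction `iterate … t` is made from the inputs
and subgradients of the rounds before `t`. -/

/-- The vector of round `t`: `0` at the start, then `g - s_t K(x_t, ·)` after each round. -/
def gradSum (x : ℕ → X) (s : ℕ → ℝ) : ℕ → 𝓗
  | 0 => 0
  | t + 1 => gradSum x s t - s t • kernelSection 𝓗 (x t)

/-- The scale of round `t`: `a L` at the start, then `α + a |s_t| ‖K(x_t, ·)‖` after each round. -/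
def scale (a L : ℝ) (x : ℕ → X) (s : ℕ → ℝ) : ℕ → ℝ
  | 0 => a * L
  | t + 1 => scale a L x s t + a * |s t| * ‖kernelSection 𝓗 (x t)‖

/-- The function that the algorithm predicts with in round `t`. -/
def iterate (a b L : ℝ) (x : ℕ → X) (s : ℕ → ℝ) (t : ℕ) : 𝓗 :=
  (b / scale 𝓗 a L x s t *
    Real.exp (‖gradSum 𝓗 x s t‖ ^ 2 / (2 * scale 𝓗 a L x s t))) • gradSum 𝓗 x s t

/-- The average of the predictors of the first `T` rounds. -/
def average (a b L : ℝ) (x : ℕ → X) (s : ℕ → ℝ) (T : ℕ) : 𝓗 :=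
  (1 / (T : ℝ)) • ∑ t ∈ Finset.range T, iterate 𝓗 a b L x s t

/-- The `s t` are admissible subgradients for `T` rounds of the algorithm with the losses `φ t`. -/
def IsRun (a b L : ℝ) (φ : ℕ → ℝ → ℝ) (x : ℕ → X) (s : ℕ → ℝ) (T : ℕ) : Prop :=
  ∀ t < T, IsSubgradient (φ t) (iterate 𝓗 a b L x s t (x t)) (s t)

end PiSTOL

end RKHS

end

/-! Each predictor is the gradient at the current g of the potential b exp(‖g‖²/(2α)). A round
therefore changes the potential by at most -s_t f_t(x_t) plus an error proportional to the relative
growth of α, since the growing α damps the exponent enough to absorb the second-order terms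
(`exp_potential_step`). The relative growths sum to O(log(α_T/α_0)), and Fenchel duality turns the
bound on the final potential into a regret of order ‖h‖√(α_T log) against every h at once
(`linear_regret_le`).

For a smooth nonnegative loss s_t² ≤ 4H ℓ_t(f_t(x_t)), so by Cauchy-Schwarz α_T is controlled by the
root of T times the algorithm's own cumulative loss (`sum_loss_le`). A predictor depends only on
earlier examples, so its expected loss is its expected risk; Jensen then gives, for the expected
cumulative loss M, the inequality M ≤ T E(h) + Õ(1 + ‖h‖(1 + (TM)^{1/4})) (`exists_expected_loss`).
Young's inequality solves it (`div_le_of_self_bounding`).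

The logarithm of ‖h‖ hidden in this inequality is O(log T) only for ‖h‖ polynomial in T. When ‖h‖ >
T², the competitor 0 replaces h at a cost L‖h‖ ≤ L‖h‖^{4/3} T^{-2/3}, which the bound already
allows. -/

/-! ### One-step growth of the exponential potential. -/

theorem exp_sub_sq_le_one_add {z : ℝ} (hz : |z| ≤ 4 / 9) : Real.exp (z - z ^ 2) ≤ 1 + z := by
  obtain ⟨h1, h2⟩ := abs_le.mp hz
  have key : 1 ≤ (1 + z) * Real.exp (-(z - z ^ 2)) := by
    rcases le_total 0 z with h | h
    · have := Real.add_one_le_exp (-(z - z ^ 2))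
      calc (1 : ℝ) ≤ (1 + z) * (-(z - z ^ 2) + 1) := by nlinarith [pow_nonneg h 3]
        _ ≤ _ := by gcongr
    -- The tangent bound only yields 1 + z³, which is too small for negative z, so the quadratic
    -- Taylor term is needed.
    · have hy : 0 ≤ -(z - z ^ 2) := by nlinarith [sq_nonneg z]
      have := Real.quadratic_le_exp_of_nonneg hy
      calc (1 : ℝ) ≤ (1 + z) * (1 + -(z - z ^ 2) + (-(z - z ^ 2)) ^ 2 / 2) := by
            have e : (1 + z) * (1 + -(z - z ^ 2) + (-(z - z ^ 2)) ^ 2 / 2) - 1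
              = z ^ 2 * (((1 + z) * (1 - z) ^ 2 + 2 * z) / 2) := by ring
            have : 0 ≤ (1 + z) * (1 - z) ^ 2 + 2 * z := by
              nlinarith [mul_nonneg (by linarith : 0 ≤ z + 4 / 9) (by linarith : 0 ≤ -z),
                mul_nonneg (mul_nonneg (by linarith : 0 ≤ z + 4 / 9) (by linarith : 0 ≤ -z))
                  (by linarith : 0 ≤ -z)]
            nlinarith [mul_nonneg (sq_nonneg z) (half_pos (by norm_num : (0:ℝ) < 1)).le,
              mul_nonneg (sq_nonneg z) this]
        _ ≤ _ := by
          have : 0 ≤ 1 + z := by linarith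
          gcongr
  have hpos := Real.exp_pos (z - z ^ 2)
  rw [Real.exp_neg] at key
  calc Real.exp (z - z ^ 2) = 1 * Real.exp (z - z ^ 2) := by ring
    _ ≤ (1 + z) * (Real.exp (z - z ^ 2))⁻¹ * Real.exp (z - z ^ 2) := by gcongr
    _ = 1 + z := by field_simp

/-- The increment of the potential in normalized coordinates. -/
theorem exp_increment_le {z θ κ Q : ℝ} (hz : |z| ≤ 4 / 9) (hQ : 0 ≤ Q)
    (hzQ : z ^ 2 ≤ Q * θ) (hθκ : 9 / 4 * θ ≤ κ) (hκ0 : 0 ≤ κ) (hκ1 : κ ≤ 1) :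
    Real.exp ((z + θ / 2 - κ * Q / 2) / (1 + κ)) ≤
      1 + z + 12 * Real.exp 8 * κ * Real.exp (-(Q / 2)) := by
  obtain ⟨h1, h2⟩ := abs_le.mp hz
  have hzz : z ^ 2 ≤ 16 / 81 := by nlinarith
  have hzκ : z ^ 2 ≤ 4 / 9 * (κ * Q) := by nlinarith
  rcases le_total 16 Q with h | h
  -- Large Q: since z² ≤ 4κQ/9, the damping -κQ/2 pays for the second-order terms and no error is
  -- left.
  · have : (z + θ / 2 - κ * Q / 2) / (1 + κ) ≤ z - z ^ 2 := by
      rw [div_le_iff₀ (by linarith)]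
      nlinarith [mul_nonneg hκ0 (sub_nonneg.2 h), mul_nonneg hκ0 (sub_nonneg.2 hzz),
        mul_nonneg hκ0 (by linarith : 0 ≤ z + 4 / 9)]
    calc _ ≤ Real.exp (z - z ^ 2) := Real.exp_le_exp.2 this
      _ ≤ 1 + z := exp_sub_sq_le_one_add hz
      _ ≤ _ := by
        have : 0 ≤ 12 * Real.exp 8 * κ * Real.exp (-(Q / 2)) := by positivity
        linarith
  -- Bounded Q: the second-order terms are O(κ), and exp(-Q/2) ≥ exp(-8) explains the constant exp
  -- 8. Here 2/3 = 2/9 + 4/9, from θ/2 ≤ 2κ/9 and z ≥ -4/9.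
  · have hE : (z + θ / 2 - κ * Q / 2) / (1 + κ) ≤ z + 2 / 3 * κ := by
      rw [div_le_iff₀ (by linarith)]
      nlinarith [mul_nonneg hκ0 hQ, mul_nonneg hκ0 (by linarith : 0 ≤ z + 4 / 9), mul_nonneg hκ0 hκ0]
    have e1 : Real.exp z ≤ 1 + z + z ^ 2 := by
      have := (abs_le.mp (Real.abs_exp_sub_one_sub_id_le (x := z) (by linarith))).2
      linarith
    have e2 : Real.exp (2 / 3 * κ) ≤ 1 + 2 * κ := by
      have := (abs_le.mp (Real.abs_exp_sub_one_sub_id_le (x := 2 / 3 * κ)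
        (by rw [abs_of_nonneg (by positivity)]; linarith))).2
      nlinarith
    have e3 : 1 ≤ Real.exp 8 * Real.exp (-(Q / 2)) := by
      rw [← Real.exp_add]; exact Real.one_le_exp (by linarith)
    calc _ ≤ Real.exp (z + 2 / 3 * κ) := Real.exp_le_exp.2 hE
      _ = Real.exp z * Real.exp (2 / 3 * κ) := Real.exp_add _ _
      _ ≤ (1 + z + z ^ 2) * (1 + 2 * κ) := by gcongr; nlinarith
      _ ≤ 1 + z + 12 * κ * 1 := by
        nlinarith [mul_nonneg hκ0 (sub_nonneg.2 h), mul_nonneg hκ0 (sub_nonneg.2 hzz),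
          mul_nonneg hκ0 (by linarith : 0 ≤ 4 / 9 - z)]
      _ ≤ 1 + z + 12 * κ * (Real.exp 8 * Real.exp (-(Q / 2))) := by gcongr
      _ = _ := by ring

/-- With z = ⟨g,v⟩/α, θ = ‖v‖²/α, κ = a‖v‖/α and Q = ‖g‖²/α this is `exp_increment_le` multiplied by
exp(Q/2). The factor exp(-Q/2) there cancels the potential, so the additive error does not grow with
‖g‖. The condition 2.25 L ≤ a is what gives |z| ≤ 4/9 and θ ≤ 4κ/9. -/
theorem exp_potential_step {E : Type*} [NormedAddCommGroup E] [InnerProductSpace ℝ E]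
    {g v : E} {α a L : ℝ} (hL : 0 < L) (haL : 2.25 * L ≤ a) (hv : ‖v‖ ≤ L)
    (hα : a * (‖g‖ + L) ≤ α) :
    Real.exp (‖g + v‖ ^ 2 / (2 * (α + a * ‖v‖))) ≤
      Real.exp (‖g‖ ^ 2 / (2 * α)) * (1 + inner ℝ g v / α) +
        12 * Real.exp 8 * (a * ‖v‖ / α) := by
  have ha : 0 < a := by linarith
  have hg := norm_nonneg g
  have hv0 := norm_nonneg v
  have hα0 : 0 < α := lt_of_lt_of_le (by positivity) hα
  have hin := abs_real_inner_le_norm g v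
  have hgα : ‖g‖ * ‖v‖ ≤ 4 / 9 * α := by
    nlinarith [mul_le_mul_of_nonneg_left hv hg, mul_le_mul_of_nonneg_right haL hg, mul_pos ha hL]
  have hκ1 : a * ‖v‖ / α ≤ 1 := by
    rw [div_le_one hα0]; nlinarith [mul_le_mul_of_nonneg_left hv ha.le, mul_nonneg ha.le hg]
  have hκ0 : 0 ≤ a * ‖v‖ / α := by positivity
  have key := exp_increment_le (z := inner ℝ g v / α) (θ := ‖v‖ ^ 2 / α) (κ := a * ‖v‖ / α)
    (Q := ‖g‖ ^ 2 / α)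
    (by rw [abs_div, abs_of_pos hα0, div_le_iff₀ hα0]; linarith) (by positivity)
    (by
      rw [div_pow, div_mul_div_comm, ← sq α, ← mul_pow]
      exact div_le_div_of_nonneg_right (sq_le_sq' (abs_le.mp hin).1 (abs_le.mp hin).2)
        (by positivity))
    (by
      rw [← mul_div_assoc]
      apply div_le_div_of_nonneg_right _ hα0.le
      nlinarith [mul_le_mul_of_nonneg_right hv hv0, mul_le_mul_of_nonneg_right haL hv0])
    hκ0 hκ1
  have hexp : ‖g + v‖ ^ 2 / (2 * (α + a * ‖v‖)) = ‖g‖ ^ 2 / (2 * α) +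
      (inner ℝ g v / α + ‖v‖ ^ 2 / α / 2 - a * ‖v‖ / α * (‖g‖ ^ 2 / α) / 2) /
        (1 + a * ‖v‖ / α) := by
    have : 0 < α + a * ‖v‖ := by positivity
    rw [norm_add_sq_real]
    field_simp
    ring
  rw [hexp, Real.exp_add]
  calc _ ≤ Real.exp (‖g‖ ^ 2 / (2 * α)) * _ := mul_le_mul_of_nonneg_left key (Real.exp_pos _).le
    _ = Real.exp (‖g‖ ^ 2 / (2 * α)) * (1 + inner ℝ g v / α) + 12 * Real.exp 8 * (a * ‖v‖ / α) *
        (Real.exp (‖g‖ ^ 2 / (2 * α)) * Real.exp (-(‖g‖ ^ 2 / α / 2))) := by ring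
    _ = _ := by
      rw [← Real.exp_add, show ‖g‖ ^ 2 / (2 * α) + -(‖g‖ ^ 2 / α / 2) = 0 by field_simp; ring,
        Real.exp_zero, mul_one]

/-- A bound for the Fenchel conjugate of `r ↦ b * exp (r ^ 2 / (2 * α))`. -/
theorem mul_le_exp_add_mul_sqrt {U r b α : ℝ} (hU : 0 ≤ U) (hb : 0 < b) (hα : 0 < α)
    (hr : 0 ≤ r) :
    U * r ≤ b * Real.exp (r ^ 2 / (2 * α)) +
      U * Real.sqrt (4 * α * Real.log (1 + Real.sqrt α * U / b)) := by
  have hs := Real.sqrt_pos.2 hα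
  have hss := Real.sq_sqrt hα.le
  have hW : 0 ≤ Real.sqrt α * U / b := by positivity
  rcases le_total (r ^ 2) (4 * α * Real.log (1 + Real.sqrt α * U / b)) with h | h
  · have := mul_le_mul_of_nonneg_left (Real.le_sqrt_of_sq_le h) hU
    have := Real.exp_pos (r ^ 2 / (2 * α))
    have := mul_pos hb this
    linarith
  -- Here exp(r²/(2α)) is a product of two equal factors: one dominates √α U/b by the case
  -- assumption, the other always dominates r/√α.
  · have h' : Real.log (1 + Real.sqrt α * U / b) ≤ r ^ 2 / (4 * α) := by
      rw [le_div_iff₀ (by positivity)]; linarith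
    have h1 : 1 + Real.sqrt α * U / b ≤ Real.exp (r ^ 2 / (4 * α)) := by
      rw [← Real.log_le_iff_le_exp (by positivity)]; exact h'
    have h2 : r / Real.sqrt α ≤ Real.exp (r ^ 2 / (4 * α)) := by
      have := Real.add_one_le_exp (r ^ 2 / (4 * α))
      have e : r ^ 2 / (4 * α) = (r / Real.sqrt α) ^ 2 / 4 := by
        rw [div_pow, hss]; field_simp
      nlinarith [sq_nonneg (r / Real.sqrt α - 2)]
    have h3 : Real.exp (r ^ 2 / (2 * α)) =
        Real.exp (r ^ 2 / (4 * α)) * Real.exp (r ^ 2 / (4 * α)) := by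
      rw [← Real.exp_add]; congr 1; field_simp; ring
    have h4 : U * r = b * ((Real.sqrt α * U / b) * (r / Real.sqrt α)) := by field_simp
    have h5 : (Real.sqrt α * U / b) * (r / Real.sqrt α) ≤ Real.exp (r ^ 2 / (2 * α)) := by
      rw [h3]; gcongr; linarith
    have := mul_le_mul_of_nonneg_left h5 hb.le
    have : 0 ≤ U * Real.sqrt (4 * α * Real.log (1 + Real.sqrt α * U / b)) := by positivity
    linarith

/-! ### Deterministic regret for the linearized losses. -/

namespace PiSTOL

section Regret

variable {X : Type*} {𝓗 : Type*} [NormedAddCommGroup 𝓗] [InnerProductSpace ℝ 𝓗]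
  [CompleteSpace 𝓗] [RKHS ℝ 𝓗 X ℝ]

theorem scale_eq (a L : ℝ) (x : ℕ → X) (s : ℕ → ℝ) (T : ℕ) :
    scale 𝓗 a L x s T =
      a * L + a * ∑ t ∈ Finset.range T, |s t| * ‖kernelSection 𝓗 (x t)‖ := by
  induction T with
  | zero => simp [scale]
  | succ t ih => rw [scale, ih, Finset.sum_range_succ]; ring

theorem gradSum_eq (x : ℕ → X) (s : ℕ → ℝ) (T : ℕ) :
    gradSum 𝓗 x s T = -∑ t ∈ Finset.range T, s t • kernelSection 𝓗 (x t) := by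
  induction T with
  | zero => simp [gradSum]
  | succ t ih => rw [gradSum, ih, Finset.sum_range_succ]; abel

/-- The scale accumulates the norms of the increments of g, so this is the triangle inequality; it
supplies the hypothesis on α in `exp_potential_step`. -/
theorem norm_gradSum_add_le_scale {a L : ℝ} (ha : 0 ≤ a) (x : ℕ → X) (s : ℕ → ℝ) (T : ℕ) :
    a * (‖gradSum 𝓗 x s T‖ + L) ≤ scale 𝓗 a L x s T := by
  rw [scale_eq, gradSum_eq, norm_neg, add_comm, mul_add]
  gcongr
  refine (norm_sum_le _ _).trans_eq (Finset.sum_congr rfl fun t _ => ?_)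
  rw [norm_smul, Real.norm_eq_abs]

theorem le_scale {a L : ℝ} (ha : 0 ≤ a) (x : ℕ → X) (s : ℕ → ℝ) (T : ℕ) :
    a * L ≤ scale 𝓗 a L x s T := by
  refine le_trans ?_ (norm_gradSum_add_le_scale ha x s T)
  gcongr
  linarith [norm_nonneg (gradSum 𝓗 x s T)]

theorem scale_le_sum_abs {a L : ℝ} (ha : 0 ≤ a) {x : ℕ → X} {s : ℕ → ℝ} {T : ℕ}
    (hk : ∀ t < T, ‖kernelSection 𝓗 (x t)‖ ≤ 1) :
    scale 𝓗 a L x s T ≤ a * L + a * ∑ t ∈ Finset.range T, |s t| := by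
  rw [scale_eq]
  gcongr with t ht
  exact mul_le_of_le_one_right (abs_nonneg _) (hk t (Finset.mem_range.1 ht))

theorem scale_le {a L : ℝ} (ha : 0 ≤ a) {x : ℕ → X} {s : ℕ → ℝ} {T : ℕ}
    (hk : ∀ t < T, ‖kernelSection 𝓗 (x t)‖ ≤ 1) (hs : ∀ t < T, |s t| ≤ L) :
    scale 𝓗 a L x s T ≤ a * L * (1 + T) := by
  have : ∑ t ∈ Finset.range T, |s t| ≤ T * L := by
    simpa using Finset.sum_le_card_nsmul (Finset.range T) (fun t => |s t|) L
      (fun t ht => hs t (Finset.mem_range.1 ht))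
  have := mul_le_mul_of_nonneg_left this ha
  linarith [scale_le_sum_abs (L := L) (s := s) ha hk]

/-- Crude and exponential in t: it serves integrability only and never enters the final rate. -/
theorem norm_iterate_le {a b L : ℝ} (ha : 0 < a) (hb : 0 < b) (hL : 0 < L)
    {x : ℕ → X} {s : ℕ → ℝ} {t : ℕ}
    (hk : ∀ i < t, ‖kernelSection 𝓗 (x i)‖ ≤ 1) (hs : ∀ i < t, |s i| ≤ L) :
    ‖iterate 𝓗 a b L x s t‖ ≤
      b / (a * L) * Real.exp ((L * t) ^ 2 / (2 * (a * L))) * (L * t) := by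
  have h1 := le_scale (𝓗 := 𝓗) (L := L) ha.le x s t
  have h2 := scale_le (𝓗 := 𝓗) ha.le hk hs
  have h3 := norm_gradSum_add_le_scale (𝓗 := 𝓗) (L := L) ha.le x s t
  have haL : 0 < a * L := by positivity
  have h4 : ‖gradSum 𝓗 x s t‖ ≤ L * t := by
    have : a * ‖gradSum 𝓗 x s t‖ ≤ a * (L * t) := by linarith
    exact le_of_mul_le_mul_left this ha
  have h5 : 0 < scale 𝓗 a L x s t := by linarith
  rw [iterate, norm_smul, Real.norm_of_nonneg (by positivity)]
  gcongr

/-- Telescoping of `exp_potential_step`: the errors a w/α are compared with the increments of log α.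
-/
theorem exp_potential_le {a b L : ℝ} (hb : 0 < b) (hL : 0 < L) (haL : 2.25 * L ≤ a)
    {x : ℕ → X} {s : ℕ → ℝ} {T : ℕ}
    (hk : ∀ t < T, ‖kernelSection 𝓗 (x t)‖ ≤ 1) (hs : ∀ t < T, |s t| ≤ L) :
    b * Real.exp (‖gradSum 𝓗 x s T‖ ^ 2 / (2 * scale 𝓗 a L x s T)) ≤
      b - ∑ t ∈ Finset.range T, s t * iterate 𝓗 a b L x s t (x t) +
        24 * Real.exp 8 * b * Real.log (scale 𝓗 a L x s T / (a * L)) := by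
  have ha : 0 < a := by linarith
  induction T with
  | zero => simp [scale, gradSum, div_self (mul_pos ha hL).ne']
  | succ t ih =>
    have ih := ih (fun i hi => hk i (by omega)) (fun i hi => hs i (by omega))
    set α := scale 𝓗 a L x s t with hα
    set g := gradSum 𝓗 x s t with hg
    have hαL : a * L ≤ α := le_scale ha.le x s t
    have hα0 : 0 < α := lt_of_lt_of_le (mul_pos ha hL) hαL
    have hv : ‖-(s t • kernelSection 𝓗 (x t))‖ = |s t| * ‖kernelSection 𝓗 (x t)‖ := by
      rw [norm_neg, norm_smul, Real.norm_eq_abs]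
    have hvL : |s t| * ‖kernelSection 𝓗 (x t)‖ ≤ L := by
      have := mul_le_mul (hs t (by omega)) (hk t (by omega)) (norm_nonneg _) hL.le
      simpa using this
    have hstep := exp_potential_step (g := g) (v := -(s t • kernelSection 𝓗 (x t))) hL haL
      (by rw [hv]; exact hvL) (norm_gradSum_add_le_scale ha.le x s t)
    rw [← hα] at hstep
    have hiter : iterate 𝓗 a b L x s t (x t) =
        b / α * Real.exp (‖g‖ ^ 2 / (2 * α)) * inner ℝ g (kernelSection 𝓗 (x t)) := by
      rw [iterate, RKHS.coe_smul, Pi.smul_apply, smul_eq_mul, ← inner_kernelSection,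
        real_inner_comm]
    set w := |s t| * ‖kernelSection 𝓗 (x t)‖ with hw
    have hw0 : 0 ≤ w := by positivity
    have hscale : scale 𝓗 a L x s (t + 1) = α + a * w := by rw [scale, hw]; ring
    have hgrad : gradSum 𝓗 x s (t + 1) = g + -(s t • kernelSection 𝓗 (x t)) := by
      rw [gradSum, sub_eq_add_neg]
    have hκ1 : a * w / α ≤ 1 := by
      rw [div_le_one hα0]
      exact (mul_le_mul_of_nonneg_left hvL ha.le).trans hαL
    have hκ0 : 0 ≤ a * w / α := by positivity
    have hlog : Real.log ((α + a * w) / (a * L)) =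
        Real.log (α / (a * L)) + Real.log (1 + a * w / α) := by
      rw [← Real.log_mul (by positivity) (by positivity)]
      congr 1
      field_simp
    -- Valid because κ = a w/α lies in [0, 1]; the factor 2 turns the constant 12 into 24.
    have hκlog : a * w / α ≤ 2 * Real.log (1 + a * w / α) := by
      have h1 := Real.one_sub_inv_le_log_of_pos (show 0 < 1 + a * w / α by positivity)
      have h2 : a * w / α / 2 ≤ 1 - (1 + a * w / α)⁻¹ := by
        have e : 1 - (1 + a * w / α)⁻¹ = (a * w / α) / (1 + a * w / α) := by
          have : 1 + a * w / α ≠ 0 := by positivity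
          generalize a * w / α = κ at *
          field_simp
          ring
        rw [e]
        gcongr
        linarith
      linarith
    rw [hscale, hgrad, Finset.sum_range_succ, hiter, hlog]
    rw [hv] at hstep
    have h1 := mul_le_mul_of_nonneg_left hstep hb.le
    have h2 := mul_le_mul_of_nonneg_left hκlog (by positivity : 0 ≤ 12 * Real.exp 8 * b)
    rw [inner_neg_right, real_inner_smul_right] at h1
    have e : b * (Real.exp (‖g‖ ^ 2 / (2 * α)) *
        (1 + -(s t * inner ℝ g (kernelSection 𝓗 (x t))) / α)) =
        b * Real.exp (‖g‖ ^ 2 / (2 * α)) - s t * (b / α * Real.exp (‖g‖ ^ 2 / (2 * α)) *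
          inner ℝ g (kernelSection 𝓗 (x t))) := by
      field_simp
      ring
    rw [mul_add b (Real.exp _ * _), e] at h1
    linarith

theorem linear_regret_le {a b L : ℝ} (hb : 0 < b) (hL : 0 < L) (haL : 2.25 * L ≤ a)
    {x : ℕ → X} {s : ℕ → ℝ} {T : ℕ}
    (hk : ∀ t < T, ‖kernelSection 𝓗 (x t)‖ ≤ 1) (hs : ∀ t < T, |s t| ≤ L) (h : 𝓗) :
    ∑ t ∈ Finset.range T, s t * (iterate 𝓗 a b L x s t (x t) - h (x t)) ≤
      b + 24 * Real.exp 8 * b * Real.log (1 + T) +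
        ‖h‖ * Real.sqrt (4 * scale 𝓗 a L x s T *
          Real.log (1 + Real.sqrt (a * L * (1 + T)) * ‖h‖ / b)) := by
  have ha : 0 < a := by linarith
  have hαL : a * L ≤ scale 𝓗 a L x s T := le_scale ha.le x s T
  have hα0 : 0 < scale 𝓗 a L x s T := lt_of_lt_of_le (mul_pos ha hL) hαL
  have hαT := scale_le (𝓗 := 𝓗) ha.le hk hs
  have h1 := exp_potential_le hb hL haL hk hs
  have h2 := mul_le_exp_add_mul_sqrt (norm_nonneg h) hb hα0 (norm_nonneg (gradSum 𝓗 x s T))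
  have h3 : ∑ t ∈ Finset.range T, s t * h (x t) = -inner ℝ h (gradSum 𝓗 x s T) := by
    rw [gradSum_eq, inner_neg_right, neg_neg, inner_sum]
    refine Finset.sum_congr rfl fun t _ => ?_
    rw [real_inner_smul_right, real_inner_comm, inner_kernelSection]
  have h4 := real_inner_le_norm h (gradSum 𝓗 x s T)
  have h5 : Real.log (scale 𝓗 a L x s T / (a * L)) ≤ Real.log (1 + T) := by
    apply Real.log_le_log (by positivity)
    rw [div_le_iff₀ (by positivity)]
    linarith
  have h6 := mul_le_mul_of_nonneg_left h5 (by positivity : 0 ≤ 24 * Real.exp 8 * b)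
  -- Only the α inside the logarithm gets its worst-case value; the outer one stays data-dependent,
  -- which the fast rate requires.
  have h7 : ‖h‖ * Real.sqrt (4 * scale 𝓗 a L x s T *
        Real.log (1 + Real.sqrt (scale 𝓗 a L x s T) * ‖h‖ / b)) ≤
      ‖h‖ * Real.sqrt (4 * scale 𝓗 a L x s T *
        Real.log (1 + Real.sqrt (a * L * (1 + T)) * ‖h‖ / b)) := by
    gcongr
  simp only [mul_sub, Finset.sum_sub_distrib]
  linarith

end Regret

end PiSTOL

/-! ### Smooth losses: self-bounding derivatives and the cumulative loss. -/

namespace IsSmoothLoss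

variable {L H : ℝ≥0} {ℓ : ℝ → ℝ}

/-- Convexity at u + w and the Lipschitz derivative give 0 ≤ ℓ(u + w) ≤ Hw² + ℓ'(u)w + ℓ(u) for
every w, so the discriminant is nonpositive. Using Hw² in place of Hw²/2 avoids an integration and
gives 4 instead of 2. -/
theorem deriv_sq_le (hℓ : IsSmoothLoss L H ℓ) (u : ℝ) : deriv ℓ u ^ 2 ≤ 4 * H * ℓ u := by
  have key : ∀ w : ℝ, 0 ≤ (H : ℝ) * (w * w) + deriv ℓ u * w + ℓ u := by
    intro w
    have h1 : ℓ (u + w) + deriv ℓ (u + w) * (u - (u + w)) ≤ ℓ u := by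
      rcases lt_trichotomy w 0 with hw | hw | hw
      · have := hℓ.convex.deriv_le_slope (Set.mem_univ (u + w)) (Set.mem_univ u) (by linarith)
          (hℓ.differentiable _)
        rw [slope_def_field, le_div_iff₀ (by linarith)] at this
        linarith
      · simp [hw]
      · have := hℓ.convex.slope_le_deriv (Set.mem_univ u) (Set.mem_univ (u + w)) (by linarith)
          (hℓ.differentiable _)
        rw [slope_def_field, div_le_iff₀ (by linarith)] at this
        linarith
    have h2 := hℓ.lipschitz_deriv.dist_le_mul (u + w) u
    rw [Real.dist_eq, Real.dist_eq, add_sub_cancel_left] at h2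
    have h3 : (deriv ℓ (u + w) - deriv ℓ u) * w ≤ H * (w * w) := by
      calc _ ≤ |(deriv ℓ (u + w) - deriv ℓ u) * w| := le_abs_self _
        _ = |deriv ℓ (u + w) - deriv ℓ u| * |w| := abs_mul _ _
        _ ≤ H * |w| * |w| := by gcongr
        _ = H * (w * w) := by rw [mul_assoc, abs_mul_abs_self]
    have := hℓ.nonneg (u + w)
    nlinarith
  have := discrim_le_zero key
  rw [discrim] at this
  linarith

/-- The point v minimizes r ↦ ℓ(yr) - rs. Since the subgradient is thus forced, the s_t are
measurable functions of the data without any assumption to that effect. -/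
theorem eq_of_isSubgradient (hℓ : IsSmoothLoss L H ℓ) {y v s : ℝ}
    (hs : IsSubgradient (fun r => ℓ (y * r)) v s) : s = y * deriv ℓ (y * v) := by
  have hd : HasDerivAt (fun r => ℓ (y * r) - r * s) (deriv ℓ (y * v) * y - s) v := by
    have h1 : HasDerivAt (fun r => y * r) y v := by simpa using (hasDerivAt_id v).const_mul y
    have h2 := (hℓ.differentiable (y * v)).hasDerivAt.comp v h1
    have h3 : HasDerivAt (fun r : ℝ => r * s) s v := by simpa using (hasDerivAt_id v).mul_const s
    exact h2.sub h3
  have hmin : IsLocalMin (fun r => ℓ (y * r) - r * s) v := by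
    refine Filter.Eventually.of_forall fun u => ?_
    have := hs u
    simp only at this ⊢
    linarith
  have := hmin.hasDerivAt_eq_zero hd
  linarith

theorem abs_deriv_le (hℓ : IsSmoothLoss L H ℓ) (u : ℝ) : |deriv ℓ u| ≤ L := by
  simpa using norm_deriv_le_of_lipschitz (x₀ := u) hℓ.lipschitz

theorem abs_le_of_isSubgradient (hℓ : IsSmoothLoss L H ℓ) {y v s : ℝ} (hy : |y| ≤ 1)
    (hs : IsSubgradient (fun r => ℓ (y * r)) v s) : |s| ≤ L := by
  rw [hℓ.eq_of_isSubgradient hs, abs_mul]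
  exact (mul_le_of_le_one_left (abs_nonneg _) hy).trans (hℓ.abs_deriv_le _)

theorem sq_le_of_isSubgradient (hℓ : IsSmoothLoss L H ℓ) {y v s : ℝ} (hy : |y| ≤ 1)
    (hs : IsSubgradient (fun r => ℓ (y * r)) v s) : s ^ 2 ≤ 4 * H * ℓ (y * v) := by
  rw [hℓ.eq_of_isSubgradient hs, mul_pow]
  exact (mul_le_of_le_one_left (sq_nonneg _) ((sq_le_one_iff_abs_le_one y).2 hy)).trans
    (hℓ.deriv_sq_le _)

end IsSmoothLoss

namespace PiSTOL

variable {X : Type*} {𝓗 : Type*} [NormedAddCommGroup 𝓗] [InnerProductSpace ℝ 𝓗]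
  [CompleteSpace 𝓗] [RKHS ℝ 𝓗 X ℝ]

/-- The cumulative loss of the algorithm against that of a fixed competitor. -/
theorem sum_loss_le {a b : ℝ} {L H : ℝ≥0} {ℓ : ℝ → ℝ} (hℓ : IsSmoothLoss L H ℓ)
    (hb : 0 < b) (hL : 0 < L) (haL : 2.25 * (L : ℝ) ≤ a)
    {x : ℕ → X} {y : ℕ → ℝ} {s : ℕ → ℝ} {T : ℕ} (hy : ∀ t, |y t| ≤ 1)
    (hk : ∀ t < T, ‖kernelSection 𝓗 (x t)‖ ≤ 1)
    (hrun : IsRun 𝓗 a b L (fun t r => ℓ (y t * r)) x s T) (h : 𝓗) :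
    ∑ t ∈ Finset.range T, ℓ (y t * iterate 𝓗 a b L x s t (x t)) ≤
      ∑ t ∈ Finset.range T, ℓ (y t * h (x t)) + (b + 24 * Real.exp 8 * b * Real.log (1 + T)) +
        ‖h‖ * Real.sqrt (4 * Real.log (1 + Real.sqrt (a * L * (1 + T)) * ‖h‖ / b)) *
          Real.sqrt (a * L + a * Real.sqrt (4 * H * T *
            ∑ t ∈ Finset.range T, ℓ (y t * iterate 𝓗 a b L x s t (x t)))) := by
  have hL' : (0 : ℝ) < L := hL
  have ha : 0 < a := by linarith
  have hs : ∀ t < T, |s t| ≤ L := fun t ht => hℓ.abs_le_of_isSubgradient (hy t) (hrun t ht)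
  have hreg := linear_regret_le (𝓗 := 𝓗) hb hL' haL hk hs h
  have hlin : ∑ t ∈ Finset.range T, ℓ (y t * iterate 𝓗 a b L x s t (x t)) -
      ∑ t ∈ Finset.range T, ℓ (y t * h (x t)) ≤
      ∑ t ∈ Finset.range T, s t * (iterate 𝓗 a b L x s t (x t) - h (x t)) := by
    rw [← Finset.sum_sub_distrib]
    refine Finset.sum_le_sum fun t ht => ?_
    have := hrun t (Finset.mem_range.1 ht) (h (x t))
    simp only at this
    linarith
  have hsq : ∑ t ∈ Finset.range T, |s t| ≤ Real.sqrt (4 * H * T *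
      ∑ t ∈ Finset.range T, ℓ (y t * iterate 𝓗 a b L x s t (x t))) := by
    apply Real.le_sqrt_of_sq_le
    -- Cauchy-Schwarz, then the self-bounding property in each round.
    calc (∑ t ∈ Finset.range T, |s t|) ^ 2 ≤ T * ∑ t ∈ Finset.range T, |s t| ^ 2 := by
          simpa using sq_sum_le_card_mul_sum_sq (s := Finset.range T) (f := fun t => |s t|)
      _ ≤ T * ∑ t ∈ Finset.range T, 4 * H * ℓ (y t * iterate 𝓗 a b L x s t (x t)) := by
        gcongr with t ht
        rw [sq_abs]
        exact hℓ.sq_le_of_isSubgradient (hy t) (hrun t (Finset.mem_range.1 ht))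
      _ = _ := by rw [← Finset.mul_sum]; ring
  have hα : scale 𝓗 a L x s T ≤ a * L + a * Real.sqrt (4 * H * T *
      ∑ t ∈ Finset.range T, ℓ (y t * iterate 𝓗 a b L x s t (x t))) :=
    (scale_le_sum_abs ha.le hk).trans (by gcongr)
  have hlog : 0 ≤ Real.log (1 + Real.sqrt (a * L * (1 + T)) * ‖h‖ / b) :=
    Real.log_nonneg (by linarith [show 0 ≤ Real.sqrt (a * L * (1 + T)) * ‖h‖ / b by positivity])
  have hfin : ‖h‖ * Real.sqrt (4 * scale 𝓗 a L x s T *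
          Real.log (1 + Real.sqrt (a * L * (1 + T)) * ‖h‖ / b)) ≤
      ‖h‖ * Real.sqrt (4 * Real.log (1 + Real.sqrt (a * L * (1 + T)) * ‖h‖ / b)) *
          Real.sqrt (a * L + a * Real.sqrt (4 * H * T *
            ∑ t ∈ Finset.range T, ℓ (y t * iterate 𝓗 a b L x s t (x t)))) := by
    rw [mul_assoc ‖h‖, ← Real.sqrt_mul (by positivity)]
    gcongr ‖h‖ * Real.sqrt ?_
    nlinarith [mul_le_mul_of_nonneg_right hα hlog]
  linarith

end PiSTOL

/-! ### The feature map and pointwise bounds on the loss. -/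

section Kernel

variable {X : Type*} {𝓗 : Type*} [NormedAddCommGroup 𝓗] [InnerProductSpace ℝ 𝓗]
  [CompleteSpace 𝓗] [RKHS ℝ 𝓗 X ℝ]

theorem inner_kernelSection_kernelSection (x x' : X) :
    inner ℝ (kernelSection 𝓗 x) (kernelSection 𝓗 x') = reproKernel 𝓗 x x' := by
  rw [inner_kernelSection, kernelSection_apply]

/-- The squared distance of two sections is K(x,x) - 2K(x,x₀) + K(x₀,x₀). Continuity is the source
of all later measurability. -/
theorem continuous_kernelSection [TopologicalSpace X]
    (hK : Continuous (fun q : X × X => reproKernel 𝓗 q.1 q.2)) :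
    Continuous (fun x : X => kernelSection 𝓗 x) := by
  rw [continuous_iff_continuousAt]
  intro x₀
  rw [ContinuousAt, tendsto_iff_norm_sub_tendsto_zero]
  have h1 : Continuous (fun x : X => Real.sqrt (reproKernel 𝓗 x x - 2 * reproKernel 𝓗 x x₀ +
      reproKernel 𝓗 x₀ x₀)) :=
    Real.continuous_sqrt.comp (((hK.comp (continuous_id.prodMk continuous_id)).sub
      ((hK.comp (continuous_id.prodMk continuous_const)).const_mul 2)).add continuous_const)
  have h2 : (fun x : X => ‖kernelSection 𝓗 x - kernelSection 𝓗 x₀‖) =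
      fun x : X => Real.sqrt (reproKernel 𝓗 x x - 2 * reproKernel 𝓗 x x₀ +
        reproKernel 𝓗 x₀ x₀) := by
    funext x
    rw [← Real.sqrt_sq (norm_nonneg (kernelSection 𝓗 x - kernelSection 𝓗 x₀)), norm_sub_sq_real,
      ← real_inner_self_eq_norm_sq, ← real_inner_self_eq_norm_sq]
    simp only [inner_kernelSection_kernelSection]
  rw [h2]
  have h3 := h1.tendsto x₀
  convert h3 using 2
  rw [show reproKernel 𝓗 x₀ x₀ - 2 * reproKernel 𝓗 x₀ x₀ + reproKernel 𝓗 x₀ x₀ = 0 by ring,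
    Real.sqrt_zero]

theorem abs_apply_le {x : X} (hx : ‖kernelSection 𝓗 x‖ ≤ 1) (f : 𝓗) : |f x| ≤ ‖f‖ := by
  rw [← inner_kernelSection]
  refine (abs_real_inner_le_norm _ _).trans ?_
  exact mul_le_of_le_one_left (norm_nonneg _) hx

variable {L H : ℝ≥0} {ℓ : ℝ → ℝ}

theorem abs_label_le_one (y : Set.Icc (-1 : ℝ) 1) : |(y : ℝ)| ≤ 1 := abs_le.2 y.2

theorem IsSmoothLoss.continuous (hℓ : IsSmoothLoss L H ℓ) : Continuous ℓ :=
  hℓ.lipschitz.continuous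

theorem IsSmoothLoss.sub_le (hℓ : IsSmoothLoss L H ℓ) (u v : ℝ) : ℓ u - ℓ v ≤ L * |u - v| := by
  have := hℓ.lipschitz.dist_le_mul u v
  rw [Real.dist_eq, Real.dist_eq] at this
  exact (le_abs_self _).trans this

theorem loss_sub_le (hℓ : IsSmoothLoss L H ℓ) {x : X} (hx : ‖kernelSection 𝓗 x‖ ≤ 1)
    (y : Set.Icc (-1 : ℝ) 1) (f g : 𝓗) :
    ℓ ((y : ℝ) * f x) - ℓ ((y : ℝ) * g x) ≤ L * ‖f - g‖ := by
  refine (hℓ.sub_le _ _).trans ?_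
  gcongr
  rw [← mul_sub, abs_mul, ← Pi.sub_apply, ← RKHS.coe_sub]
  exact (mul_le_of_le_one_left (abs_nonneg _) (abs_label_le_one y)).trans (abs_apply_le hx _)

theorem loss_le (hℓ : IsSmoothLoss L H ℓ) {x : X} (hx : ‖kernelSection 𝓗 x‖ ≤ 1)
    (y : Set.Icc (-1 : ℝ) 1) (f : 𝓗) : ℓ ((y : ℝ) * f x) ≤ ℓ 0 + L * ‖f‖ := by
  have := loss_sub_le hℓ hx y f 0
  simp only [RKHS.coe_zero, Pi.zero_apply, mul_zero, sub_zero] at this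
  linarith

end Kernel

/-! ### The risk as a convex Lipschitz functional on the Hilbert space. -/

section Risk

variable {X : Type*} [MeasurableSpace X] {𝓗 : Type*} [NormedAddCommGroup 𝓗]
  [InnerProductSpace ℝ 𝓗] [CompleteSpace 𝓗] [RKHS ℝ 𝓗 X ℝ]
  {ρ : Measure (X × Set.Icc (-1 : ℝ) 1)} {L H : ℝ≥0} {ℓ : ℝ → ℝ}

theorem stronglyMeasurable_apply (hk : StronglyMeasurable (fun x : X => kernelSection 𝓗 x))
    {Ω : Type*} [MeasurableSpace Ω] {F : Ω → 𝓗} (hF : StronglyMeasurable F) {x : Ω → X}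
    (hx : Measurable x) : StronglyMeasurable (fun ω => F ω (x ω)) := by
  simp only [← inner_kernelSection]
  exact (hk.comp_measurable hx).inner hF

theorem integrable_loss [IsFiniteMeasure ρ] (hℓ : IsSmoothLoss L H ℓ)
    (hk : StronglyMeasurable (fun x : X => kernelSection 𝓗 x))
    (hρ : ∀ᵐ z ∂ρ, ‖kernelSection 𝓗 z.1‖ ≤ 1) (f : 𝓗) :
    Integrable (fun z => ℓ ((z.2 : ℝ) * f z.1)) ρ := by
  have hm : Measurable (fun z : X × Set.Icc (-1 : ℝ) 1 => (z.2 : ℝ) * f z.1) :=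
    (measurable_subtype_coe.comp measurable_snd).mul
      (stronglyMeasurable_apply hk stronglyMeasurable_const measurable_fst).measurable
  refine Integrable.of_bound (hℓ.continuous.measurable.comp hm).aestronglyMeasurable
    (ℓ 0 + L * ‖f‖) ?_
  filter_upwards [hρ] with z hz
  rw [Real.norm_of_nonneg (hℓ.nonneg _)]
  exact loss_le hℓ hz z.2 f

theorem lossRisk_nonneg (hℓ : IsSmoothLoss L H ℓ) (f : X → ℝ) : 0 ≤ lossRisk ρ ℓ f :=
  integral_nonneg fun _ => hℓ.nonneg _

theorem lossRisk_sub_le [IsProbabilityMeasure ρ] (hℓ : IsSmoothLoss L H ℓ)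
    (hk : StronglyMeasurable (fun x : X => kernelSection 𝓗 x))
    (hρ : ∀ᵐ z ∂ρ, ‖kernelSection 𝓗 z.1‖ ≤ 1) (f g : 𝓗) :
    lossRisk ρ ℓ f - lossRisk ρ ℓ g ≤ L * ‖f - g‖ := by
  rw [lossRisk, lossRisk, ← integral_sub (integrable_loss hℓ hk hρ f) (integrable_loss hℓ hk hρ g)]
  calc _ ≤ ∫ _ : X × Set.Icc (-1 : ℝ) 1, L * ‖f - g‖ ∂ρ := by
        refine integral_mono_ae ((integrable_loss hℓ hk hρ f).sub (integrable_loss hℓ hk hρ g))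
          (integrable_const _) ?_
        filter_upwards [hρ] with z hz
        exact loss_sub_le hℓ hz z.2 f g
    _ = _ := by simp

theorem continuous_lossRisk [IsProbabilityMeasure ρ] (hℓ : IsSmoothLoss L H ℓ)
    (hk : StronglyMeasurable (fun x : X => kernelSection 𝓗 x))
    (hρ : ∀ᵐ z ∂ρ, ‖kernelSection 𝓗 z.1‖ ≤ 1) :
    Continuous (fun f : 𝓗 => lossRisk ρ ℓ f) := by
  refine LipschitzWith.continuous (K := L) (LipschitzWith.of_dist_le_mul fun f g => ?_)
  rw [Real.dist_eq, dist_eq_norm, abs_le]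
  have h1 := lossRisk_sub_le hℓ hk hρ f g
  have h2 := lossRisk_sub_le hℓ hk hρ g f
  rw [norm_sub_rev] at h2
  constructor <;> linarith

theorem convexOn_lossRisk [IsProbabilityMeasure ρ] (hℓ : IsSmoothLoss L H ℓ)
    (hk : StronglyMeasurable (fun x : X => kernelSection 𝓗 x))
    (hρ : ∀ᵐ z ∂ρ, ‖kernelSection 𝓗 z.1‖ ≤ 1) :
    ConvexOn ℝ Set.univ (fun f : 𝓗 => lossRisk ρ ℓ f) := by
  refine ⟨convex_univ, fun f _ g _ c d hc hd hcd => ?_⟩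
  simp only [smul_eq_mul, lossRisk]
  rw [← integral_const_mul, ← integral_const_mul, ← integral_add
    ((integrable_loss hℓ hk hρ f).const_mul c) ((integrable_loss hℓ hk hρ g).const_mul d)]
  refine integral_mono (integrable_loss hℓ hk hρ _)
    (((integrable_loss hℓ hk hρ f).const_mul c).add ((integrable_loss hℓ hk hρ g).const_mul d))
    fun z => ?_
  have := hℓ.convex.2 (Set.mem_univ ((z.2 : ℝ) * f z.1)) (Set.mem_univ ((z.2 : ℝ) * g z.1)) hc hd
    hcd
  simp only [smul_eq_mul] at this
  simp only [RKHS.coe_add, RKHS.coe_smul, Pi.add_apply, Pi.smul_apply, smul_eq_mul]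
  convert this using 2
  ring

theorem lossRisk_average_le [IsProbabilityMeasure ρ] (hℓ : IsSmoothLoss L H ℓ)
    (hk : StronglyMeasurable (fun x : X => kernelSection 𝓗 x))
    (hρ : ∀ᵐ z ∂ρ, ‖kernelSection 𝓗 z.1‖ ≤ 1) {T : ℕ} (hT : 1 ≤ T) (F : ℕ → 𝓗) :
    lossRisk ρ ℓ ((1 / (T : ℝ)) • ∑ t ∈ Finset.range T, F t : 𝓗) ≤
      1 / T * ∑ t ∈ Finset.range T, lossRisk ρ ℓ (F t) := by
  have hT0 : (T : ℝ) ≠ 0 := by positivity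
  have := (convexOn_lossRisk (𝓗 := 𝓗) hℓ hk hρ).map_sum_le (t := Finset.range T)
    (w := fun _ => 1 / (T : ℝ)) (p := F) (fun _ _ => by positivity) (by simp [hT0])
    (fun _ _ => Set.mem_univ _)
  rwa [← Finset.smul_sum, ← Finset.smul_sum] at this

/-- The loss of a random predictor on an independent example has the risk of the predictor as
its mean. -/
theorem integral_loss_eq_integral_lossRisk [TopologicalSpace X] [SecondCountableTopology X]
    [OpensMeasurableSpace X] [IsProbabilityMeasure ρ] (hℓ : IsSmoothLoss L H ℓ)
    (hk : Continuous (fun x : X => kernelSection 𝓗 x))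
    (hρ : ∀ᵐ z ∂ρ, ‖kernelSection 𝓗 z.1‖ ≤ 1)
    {Ω : Type*} {m : MeasurableSpace Ω} [MeasurableSpace Ω] {P : Measure Ω}
    [IsProbabilityMeasure P] {F : Ω → 𝓗} (hF : StronglyMeasurable F) {B : ℝ} (hB : ∀ᵐ ω ∂P, ‖F ω‖ ≤ B)
    {x : Ω → X} {y : Ω → Set.Icc (-1 : ℝ) 1} (hz : Measurable (fun ω => (x ω, y ω)))
    (hzρ : P.map (fun ω => (x ω, y ω)) = ρ)
    (hFm : StronglyMeasurable[m] F)
    (hind : Indep m (MeasurableSpace.comap (fun ω => (x ω, y ω)) inferInstance) P) :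
    Integrable (fun ω => ℓ ((y ω : ℝ) * F ω (x ω))) P ∧
      ∫ ω, ℓ ((y ω : ℝ) * F ω (x ω)) ∂P = ∫ ω, lossRisk ρ ℓ (F ω) ∂P := by
  borelize 𝓗
  have hFmeas : Measurable F := hF.measurable
  have hindF : IndepFun F (fun ω => (x ω, y ω)) P := by
    rw [IndepFun_iff_Indep]
    exact indep_of_indep_of_le_left hind hFm.measurable.comap_le
  have hmap : P.map (fun ω => (F ω, (x ω, y ω))) = (P.map F).prod ρ := by
    rw [(indepFun_iff_map_prod_eq_prod_map_map hFmeas.aemeasurable hz.aemeasurable).1 hindF, hzρ]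
  have hpair : Measurable (fun ω => (F ω, (x ω, y ω))) := hFmeas.prodMk hz
  -- Evaluation is jointly continuous in the function and the point; second countability of X makes
  -- this enough, with no separability of `𝓗`.
  have hψ : Measurable (fun q : 𝓗 × (X × Set.Icc (-1 : ℝ) 1) =>
      ℓ ((q.2.2 : ℝ) * q.1 q.2.1)) := by
    refine Continuous.measurable ?_
    simp only [← inner_kernelSection]
    have := hℓ.continuous
    fun_prop
  have hzk : ∀ᵐ ω ∂P, ‖kernelSection 𝓗 (x ω)‖ ≤ 1 := by
    rw [← hzρ] at hρ
    exact ae_of_ae_map hz.aemeasurable hρ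
  have hint : Integrable (fun ω => ℓ ((y ω : ℝ) * F ω (x ω))) P := by
    refine Integrable.of_bound (hψ.comp hpair).aestronglyMeasurable (ℓ 0 + L * B) ?_
    filter_upwards [hB, hzk] with ω h1 h2
    rw [Real.norm_of_nonneg (hℓ.nonneg _)]
    refine (loss_le hℓ h2 _ _).trans ?_
    gcongr
  refine ⟨hint, ?_⟩
  have hintprod : Integrable (fun q : 𝓗 × (X × Set.Icc (-1 : ℝ) 1) =>
      ℓ ((q.2.2 : ℝ) * q.1 q.2.1)) ((P.map F).prod ρ) := by
    rw [← hmap, integrable_map_measure hψ.aestronglyMeasurable hpair.aemeasurable]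
    exact hint
  have : IsProbabilityMeasure (P.map F) := Measure.isProbabilityMeasure_map hFmeas.aemeasurable
  calc ∫ ω, ℓ ((y ω : ℝ) * F ω (x ω)) ∂P
      = ∫ q, ℓ ((q.2.2 : ℝ) * q.1 q.2.1) ∂(P.map (fun ω => (F ω, (x ω, y ω)))) :=
        (integral_map hpair.aemeasurable hψ.aestronglyMeasurable).symm
    _ = ∫ f, lossRisk ρ ℓ f ∂(P.map F) := by rw [hmap, integral_prod _ hintprod]; rfl
    _ = ∫ ω, lossRisk ρ ℓ (F ω) ∂P :=
        integral_map hFmeas.aemeasurable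
          ((continuous_lossRisk hℓ hk.stronglyMeasurable hρ).measurable.aestronglyMeasurable)

end Risk

/-! ### Measurability of the predictors. -/

namespace PiSTOL

variable {X : Type*} {𝓗 : Type*} [NormedAddCommGroup 𝓗]
  [InnerProductSpace ℝ 𝓗] [CompleteSpace 𝓗] [RKHS ℝ 𝓗 X ℝ]

theorem stronglyMeasurable_iterate_of {a b L : ℝ} {Ω : Type*} [MeasurableSpace Ω]
    {x : ℕ → Ω → X} {s : ℕ → Ω → ℝ} {t : ℕ}
    (hg : StronglyMeasurable (fun ω => gradSum 𝓗 (fun i => x i ω) (fun i => s i ω) t))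
    (hα : Measurable (fun ω => scale 𝓗 a L (fun i => x i ω) (fun i => s i ω) t)) :
    StronglyMeasurable (fun ω => iterate 𝓗 a b L (fun i => x i ω) (fun i => s i ω) t) := by
  have hn := hg.norm.measurable
  exact (((hα.const_div b).mul
    (((hn.pow_const 2).div (hα.const_mul 2)).exp)).stronglyMeasurable).smul hg

variable [MeasurableSpace X]

/-- The predictor of round `t` is a measurable function of the examples of the rounds before. -/
theorem stronglyMeasurable_iterate {a b : ℝ} {L H : ℝ≥0} {ℓ : ℝ → ℝ} (hℓ : IsSmoothLoss L H ℓ)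
    (hk : StronglyMeasurable (fun x : X => kernelSection 𝓗 x))
    {Ω : Type*} [MeasurableSpace Ω] {x : ℕ → Ω → X} {y : ℕ → Ω → ℝ} {s : ℕ → Ω → ℝ} {t : ℕ}
    (hx : ∀ i < t, Measurable (x i)) (hy : ∀ i < t, Measurable (y i))
    (hrun : ∀ ω, IsRun 𝓗 a b L (fun i r => ℓ (y i ω * r)) (fun i => x i ω) (fun i => s i ω) t) :
    StronglyMeasurable (fun ω => iterate 𝓗 a b L (fun i => x i ω) (fun i => s i ω) t) := by
  suffices h : StronglyMeasurable (fun ω => gradSum 𝓗 (fun i => x i ω) (fun i => s i ω) t) ∧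
      Measurable (fun ω => scale 𝓗 a L (fun i => x i ω) (fun i => s i ω) t) from
    stronglyMeasurable_iterate_of h.1 h.2
  induction t with
  | zero => exact ⟨stronglyMeasurable_const, measurable_const⟩
  | succ t ih =>
    obtain ⟨hg, hα⟩ := ih (fun i hi => hx i (by omega)) (fun i hi => hy i (by omega))
      (fun ω i hi => hrun ω i (by omega))
    have hit := stronglyMeasurable_iterate_of (b := b) hg hα
    have hxt := hx t (by omega)
    have hyt := hy t (by omega)
    have hst : Measurable (s t) := by
      have : s t = fun ω => y t ω * deriv ℓ (y t ω *
          iterate 𝓗 a b L (fun i => x i ω) (fun i => s i ω) t (x t ω)) := by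
        funext ω
        exact hℓ.eq_of_isSubgradient (hrun ω t (by omega))
      rw [this]
      exact hyt.mul ((hℓ.lipschitz_deriv.continuous.measurable).comp
        (hyt.mul (stronglyMeasurable_apply hk hit hxt).measurable))
    have hkt := hk.comp_measurable hxt
    exact ⟨hg.sub (hst.stronglyMeasurable.smul hkt),
      hα.add ((hst.abs.const_mul a).mul hkt.norm.measurable)⟩

end PiSTOL

/-! ### Jensen's inequality and independence from the past. -/

/-- Jensen for the concave root; integrability comes from √f ≤ 1 + f. -/
theorem integral_sqrt_le {Ω : Type*} [MeasurableSpace Ω] {P : Measure Ω} [IsProbabilityMeasure P]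
    {f : Ω → ℝ} (hf : Integrable f P) (hf0 : ∀ ω, 0 ≤ f ω) :
    Integrable (fun ω => Real.sqrt (f ω)) P ∧
      ∫ ω, Real.sqrt (f ω) ∂P ≤ Real.sqrt (∫ ω, f ω ∂P) := by
  have hint : Integrable (fun ω => Real.sqrt (f ω)) P := by
    refine ((integrable_const 1).add hf).mono'
      (Real.continuous_sqrt.comp_aestronglyMeasurable hf.aestronglyMeasurable)
      (Filter.Eventually.of_forall fun ω => ?_)
    rw [Real.norm_of_nonneg (Real.sqrt_nonneg _), Pi.add_apply, Real.sqrt_le_left]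
    · nlinarith [hf0 ω]
    · linarith [hf0 ω]
  exact ⟨hint, Real.strictConcaveOn_sqrt.concaveOn.le_map_integral
    Real.continuous_sqrt.continuousOn isClosed_Ici (Filter.Eventually.of_forall hf0) hf hint⟩

/-- The σ-algebra generated by the examples of the rounds before `t`. -/
abbrev priorExamples {Ω Z : Type*} [MeasurableSpace Z] {T : ℕ} (z : Fin T → Ω → Z) (t : ℕ) :
    MeasurableSpace Ω :=
  ⨆ i ∈ {i : Fin T | (i : ℕ) < t}, MeasurableSpace.comap (z i) inferInstance

theorem measurable_priorExamples {Ω Z : Type*} [MeasurableSpace Z] {T : ℕ} (z : Fin T → Ω → Z)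
    {t : ℕ} {i : Fin T} (hi : (i : ℕ) < t) : Measurable[priorExamples z t] (z i) :=
  (comap_measurable (z i)).mono
    (le_iSup₂_of_le (f := fun (j : Fin T) (_ : j ∈ {i : Fin T | (i : ℕ) < t}) =>
      MeasurableSpace.comap (z j) inferInstance) i hi le_rfl) le_rfl

theorem indep_priorExamples {Ω Z : Type*} [MeasurableSpace Z] [MeasurableSpace Ω] {P : Measure Ω}
    {T : ℕ} {z : Fin T → Ω → Z} (hz : ∀ i, Measurable (z i)) (hind : iIndepFun z P) (t : Fin T) :
    Indep (priorExamples z t) (MeasurableSpace.comap (z t) inferInstance) P := by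
  have := indep_iSup_of_disjoint (S := {i : Fin T | (i : ℕ) < t}) (T := {t})
    (fun i => (hz i).comap_le) hind.iIndep (by simp)
  simpa [priorExamples] using this

/-! ### Online-to-batch conversion. -/

namespace PiSTOL

variable {X : Type*} [MeasurableSpace X] {𝓗 : Type*} [NormedAddCommGroup 𝓗]
  [InnerProductSpace ℝ 𝓗] [CompleteSpace 𝓗] [RKHS ℝ 𝓗 X ℝ]
  {ρ : Measure (X × Set.Icc (-1 : ℝ) 1)} {L H : ℝ≥0} {ℓ : ℝ → ℝ}
  {Ω : Type*} [MeasurableSpace Ω] {P : Measure Ω}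
  {x : ℕ → Ω → X} {y : ℕ → Ω → Set.Icc (-1 : ℝ) 1} {s : ℕ → Ω → ℝ} {T : ℕ} {a b : ℝ}

theorem ae_norm_kernelSection_le
    (hρ : ∀ᵐ z ∂ρ, ‖kernelSection 𝓗 z.1‖ ≤ 1)
    (hz : ∀ t < T, Measurable (fun ω => (x t ω, y t ω)) ∧
      P.map (fun ω => (x t ω, y t ω)) = ρ) :
    ∀ᵐ ω ∂P, ∀ t < T, ‖kernelSection 𝓗 (x t ω)‖ ≤ 1 := by
  rw [ae_all_iff]
  intro t
  by_cases ht : t < T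
  · have h := hρ
    rw [← (hz t ht).2] at h
    filter_upwards [ae_of_ae_map (hz t ht).1.aemeasurable h] with ω hω _ using hω
  · exact Filter.Eventually.of_forall fun ω h => absurd h ht

variable [TopologicalSpace X] [SecondCountableTopology X] [OpensMeasurableSpace X]
  [IsProbabilityMeasure ρ] [IsProbabilityMeasure P]

/-- In each round, the loss suffered has the risk of the predictor as its mean. -/
theorem integral_loss_iterate (hℓ : IsSmoothLoss L H ℓ)
    (hk : Continuous (fun x : X => kernelSection 𝓗 x))
    (hρ : ∀ᵐ z ∂ρ, ‖kernelSection 𝓗 z.1‖ ≤ 1)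
    (hb : 0 < b) (hL : 0 < L) (haL : 2.25 * (L : ℝ) ≤ a)
    (hz : ∀ t < T, Measurable (fun ω => (x t ω, y t ω)) ∧
      P.map (fun ω => (x t ω, y t ω)) = ρ)
    (hind : iIndepFun (fun (t : Fin T) ω => (x t ω, y t ω)) P)
    (hrun : ∀ ω, IsRun 𝓗 a b L (fun t r => ℓ ((y t ω : ℝ) * r))
      (fun t => x t ω) (fun t => s t ω) T) {t : ℕ} (ht : t < T) :
    Integrable (fun ω => ℓ ((y t ω : ℝ) *
        iterate 𝓗 a b L (fun t => x t ω) (fun t => s t ω) t (x t ω))) P ∧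
      Integrable (fun ω =>
        lossRisk ρ ℓ (iterate 𝓗 a b L (fun t => x t ω) (fun t => s t ω) t)) P ∧
      ∫ ω, ℓ ((y t ω : ℝ) *
          iterate 𝓗 a b L (fun t => x t ω) (fun t => s t ω) t (x t ω)) ∂P =
        ∫ ω, lossRisk ρ ℓ (iterate 𝓗 a b L (fun t => x t ω) (fun t => s t ω) t) ∂P := by
  have hL' : (0 : ℝ) < L := hL
  have ha : 0 < a := by linarith
  have hrunt : ∀ ω, IsRun 𝓗 a b L (fun i r => ℓ ((y i ω : ℝ) * r)) (fun i => x i ω)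
      (fun i => s i ω) t := fun ω i hi => hrun ω i (hi.trans ht)
  have hF : StronglyMeasurable (fun ω => iterate 𝓗 a b L (fun i => x i ω) (fun i => s i ω) t) :=
    stronglyMeasurable_iterate (y := fun i ω => (y i ω : ℝ)) hℓ hk.stronglyMeasurable
      (fun i hi => measurable_fst.comp (hz i (hi.trans ht)).1)
      (fun i hi => measurable_subtype_coe.comp (measurable_snd.comp (hz i (hi.trans ht)).1)) hrunt
  have hFm : StronglyMeasurable[priorExamples (fun (i : Fin T) ω => (x i ω, y i ω)) t]
      (fun ω => iterate 𝓗 a b L (fun i => x i ω) (fun i => s i ω) t) :=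
    -- The same lemma over the smaller σ-algebra shows that the predictor is determined by the past,
    -- hence independent of the current example.
    @stronglyMeasurable_iterate X 𝓗 _ _ _ _ _ a b L H ℓ hℓ hk.stronglyMeasurable Ω
      (priorExamples (fun (i : Fin T) ω => (x i ω, y i ω)) t) x (fun i ω => (y i ω : ℝ)) s t
      (fun i hi => measurable_fst.comp
        (measurable_priorExamples (fun (i : Fin T) ω => (x i ω, y i ω)) (i := ⟨i, hi.trans ht⟩) hi))
      (fun i hi => measurable_subtype_coe.comp (measurable_snd.comp
        (measurable_priorExamples (fun (i : Fin T) ω => (x i ω, y i ω)) (i := ⟨i, hi.trans ht⟩) hi)))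
      hrunt
  have hindm := indep_priorExamples (fun i => (hz i i.2).1) hind ⟨t, ht⟩
  have hB : ∀ᵐ ω ∂P, ‖iterate 𝓗 a b L (fun i => x i ω) (fun i => s i ω) t‖ ≤
      b / (a * L) * Real.exp ((L * t) ^ 2 / (2 * (a * L))) * (L * t) := by
    filter_upwards [ae_norm_kernelSection_le (𝓗 := 𝓗) hρ hz] with ω hω
    exact norm_iterate_le ha hb hL' (fun i hi => hω i (hi.trans ht))
      (fun i hi => hℓ.abs_le_of_isSubgradient (abs_label_le_one _) (hrunt ω i hi))
  obtain ⟨h1, h2⟩ := integral_loss_eq_integral_lossRisk hℓ hk hρ hF hB (hz t ht).1 (hz t ht).2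
    hFm hindm
  refine ⟨h1, ?_, h2⟩
  refine Integrable.of_bound ((continuous_lossRisk hℓ hk.stronglyMeasurable
    hρ).comp_stronglyMeasurable hF).aestronglyMeasurable (lossRisk ρ ℓ (0 : 𝓗) + L *
      (b / (a * L) * Real.exp ((L * t) ^ 2 / (2 * (a * L))) * (L * t))) ?_
  filter_upwards [hB] with ω hω
  rw [Real.norm_of_nonneg (lossRisk_nonneg hℓ _)]
  have := lossRisk_sub_le (𝓗 := 𝓗) hℓ hk.stronglyMeasurable hρ
    (iterate 𝓗 a b L (fun i => x i ω) (fun i => s i ω) t) 0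
  rw [sub_zero] at this
  have := mul_le_mul_of_nonneg_left hω hL'.le
  linarith

/-- The expected risk of the average of the predictors is controlled by the expected cumulative
loss `M`, which satisfies a self-bounding inequality. -/
theorem exists_expected_loss (hℓ : IsSmoothLoss L H ℓ)
    (hk : Continuous (fun x : X => kernelSection 𝓗 x))
    (hρ : ∀ᵐ z ∂ρ, ‖kernelSection 𝓗 z.1‖ ≤ 1)
    (hb : 0 < b) (hL : 0 < L) (haL : 2.25 * (L : ℝ) ≤ a) (hT : 1 ≤ T)
    (hz : ∀ t < T, Measurable (fun ω => (x t ω, y t ω)) ∧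
      P.map (fun ω => (x t ω, y t ω)) = ρ)
    (hind : iIndepFun (fun (t : Fin T) ω => (x t ω, y t ω)) P)
    (hrun : ∀ ω, IsRun 𝓗 a b L (fun t r => ℓ ((y t ω : ℝ) * r))
      (fun t => x t ω) (fun t => s t ω) T) :
    Integrable (fun ω => lossRisk ρ ℓ
        (average 𝓗 a b L (fun t => x t ω) (fun t => s t ω) T)) P ∧
      ∃ M : ℝ, 0 ≤ M ∧
        ∫ ω, lossRisk ρ ℓ (average 𝓗 a b L (fun t => x t ω) (fun t => s t ω) T) ∂P ≤ M / T ∧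
        ∀ h : 𝓗, M ≤ T * lossRisk ρ ℓ h + (b + 24 * Real.exp 8 * b * Real.log (1 + T)) +
          ‖h‖ * Real.sqrt (4 * Real.log (1 + Real.sqrt (a * L * (1 + T)) * ‖h‖ / b)) *
            Real.sqrt (a * L + a * Real.sqrt (4 * H * T * M)) := by
  have hL' : (0 : ℝ) < L := hL
  have ha : 0 < a := by linarith
  have hround := fun t ht => integral_loss_iterate (t := t) hℓ hk hρ hb hL haL hz hind hrun ht
  set f : ℕ → Ω → 𝓗 := fun t ω => iterate 𝓗 a b L (fun t => x t ω) (fun t => s t ω) t with hf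
  set Λ : Ω → ℝ := fun ω => ∑ t ∈ Finset.range T, ℓ ((y t ω : ℝ) * f t ω (x t ω)) with hΛ
  have hΛ0 : ∀ ω, 0 ≤ Λ ω := fun ω => Finset.sum_nonneg fun t _ => hℓ.nonneg _
  have hΛint : Integrable Λ P :=
    integrable_finsetSum _ fun t ht => (hround t (Finset.mem_range.1 ht)).1
  have hRint : Integrable (fun ω => 1 / (T : ℝ) * ∑ t ∈ Finset.range T, lossRisk ρ ℓ (f t ω)) P :=
    (integrable_finsetSum _ fun t ht => (hround t (Finset.mem_range.1 ht)).2.1).const_mul _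
  have hΛR : ∫ ω, (1 / (T : ℝ) * ∑ t ∈ Finset.range T, lossRisk ρ ℓ (f t ω)) ∂P =
      (∫ ω, Λ ω ∂P) / T := by
    rw [integral_const_mul, integral_finsetSum _ fun t ht =>
      (hround t (Finset.mem_range.1 ht)).2.1, hΛ, integral_finsetSum _ fun t ht =>
      (hround t (Finset.mem_range.1 ht)).1, one_div_mul_eq_div]
    congr 1
    exact Finset.sum_congr rfl fun t ht => ((hround t (Finset.mem_range.1 ht)).2.2).symm
  have hconv : ∀ ω, lossRisk ρ ℓ (average 𝓗 a b L (fun t => x t ω) (fun t => s t ω) T) ≤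
      1 / (T : ℝ) * ∑ t ∈ Finset.range T, lossRisk ρ ℓ (f t ω) := fun ω =>
    lossRisk_average_le hℓ hk.stronglyMeasurable hρ hT (fun t => f t ω)
  have hfm : ∀ t < T, StronglyMeasurable (f t) := fun t ht =>
    stronglyMeasurable_iterate (y := fun i ω => (y i ω : ℝ)) hℓ hk.stronglyMeasurable
      (fun i hi => measurable_fst.comp (hz i (hi.trans ht)).1)
      (fun i hi => measurable_subtype_coe.comp (measurable_snd.comp (hz i (hi.trans ht)).1))
      (fun ω i hi => hrun ω i (hi.trans ht))
  have havg : StronglyMeasurable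
      (fun ω => average 𝓗 a b L (fun t => x t ω) (fun t => s t ω) T) := by
    have := (Finset.stronglyMeasurable_fun_sum (Finset.range T) (f := f)
      fun t ht => hfm t (Finset.mem_range.1 ht)).const_smul (1 / (T : ℝ))
    exact this
  have hint : Integrable (fun ω => lossRisk ρ ℓ
      (average 𝓗 a b L (fun t => x t ω) (fun t => s t ω) T)) P := by
    refine hRint.mono' ((continuous_lossRisk hℓ hk.stronglyMeasurable
      hρ).comp_stronglyMeasurable havg).aestronglyMeasurable
      (Filter.Eventually.of_forall fun ω => ?_)
    rw [Real.norm_of_nonneg (lossRisk_nonneg hℓ _)]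
    exact hconv ω
  refine ⟨hint, ∫ ω, Λ ω ∂P, integral_nonneg hΛ0, ?_, fun h => ?_⟩
  · rw [← hΛR]
    exact integral_mono hint hRint hconv
  · have hloss : ∀ t < T, Integrable (fun ω => ℓ ((y t ω : ℝ) * h (x t ω))) P ∧
        ∫ ω, ℓ ((y t ω : ℝ) * h (x t ω)) ∂P = lossRisk ρ ℓ h := by
      intro t ht
      -- A fixed competitor is a constant predictor, independent of everything through the trivial
      -- σ-algebra.
      have := integral_loss_eq_integral_lossRisk (P := P) (F := fun _ => h) (B := ‖h‖) hℓ hk hρ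
        stronglyMeasurable_const (by simp) (hz t ht).1 (hz t ht).2 (m := ⊥)
        stronglyMeasurable_const (indep_bot_left _)
      simpa using this
    have hcomp : Integrable (fun ω => ∑ t ∈ Finset.range T, ℓ ((y t ω : ℝ) * h (x t ω))) P :=
      integrable_finsetSum _ fun t ht => (hloss t (Finset.mem_range.1 ht)).1
    have hcompR : ∫ ω, ∑ t ∈ Finset.range T, ℓ ((y t ω : ℝ) * h (x t ω)) ∂P =
        T * lossRisk ρ ℓ h := by
      rw [integral_finsetSum _ fun t ht => (hloss t (Finset.mem_range.1 ht)).1,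
        Finset.sum_congr rfl fun t ht => (hloss t (Finset.mem_range.1 ht)).2]
      simp
    have hq := integral_sqrt_le (P := P) (f := fun ω => 4 * H * T * Λ ω) (hΛint.const_mul _)
      (fun ω => mul_nonneg (by positivity) (hΛ0 ω))
    -- The roots are nested, so Jensen is applied twice and only the mean of Λ remains.
    have hr := integral_sqrt_le (P := P)
      (f := fun ω => a * L + a * Real.sqrt (4 * H * T * Λ ω))
      ((integrable_const _).add (hq.1.const_mul a)) (fun ω => by positivity)
    set c := b + 24 * Real.exp 8 * b * Real.log (1 + T) with hc
    set D := ‖h‖ * Real.sqrt (4 * Real.log (1 + Real.sqrt (a * L * (1 + T)) * ‖h‖ / b)) with hD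
    have hD0 : 0 ≤ D := by positivity
    have hpath : ∀ᵐ ω ∂P, Λ ω ≤ ∑ t ∈ Finset.range T, ℓ ((y t ω : ℝ) * h (x t ω)) + c +
        D * Real.sqrt (a * L + a * Real.sqrt (4 * H * T * Λ ω)) := by
      filter_upwards [ae_norm_kernelSection_le (𝓗 := 𝓗) hρ hz] with ω hω
      exact sum_loss_le hℓ hb hL haL (y := fun t => (y t ω : ℝ)) (fun t => abs_label_le_one _) hω
        (hrun ω) h
    calc ∫ ω, Λ ω ∂P ≤ ∫ ω, (∑ t ∈ Finset.range T, ℓ ((y t ω : ℝ) * h (x t ω)) + c +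
          D * Real.sqrt (a * L + a * Real.sqrt (4 * H * T * Λ ω))) ∂P :=
          integral_mono_ae hΛint ((hcomp.add (integrable_const c)).add (hr.1.const_mul D)) hpath
      _ = T * lossRisk ρ ℓ h + c +
          D * ∫ ω, Real.sqrt (a * L + a * Real.sqrt (4 * H * T * Λ ω)) ∂P := by
        have hcompc : Integrable
            (fun ω => ∑ t ∈ Finset.range T, ℓ ((y t ω : ℝ) * h (x t ω)) + c) P :=
          hcomp.add (integrable_const c)
        rw [integral_add hcompc (hr.1.const_mul D), integral_add hcomp (integrable_const c),
          hcompR, integral_const_mul]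
        simp
      _ ≤ T * lossRisk ρ ℓ h + c +
          D * Real.sqrt (a * L + a * Real.sqrt (4 * H * T * ∫ ω, Λ ω ∂P)) := by
        gcongr
        refine hr.2.trans ?_
        gcongr
        rw [integral_add (integrable_const _) (hq.1.const_mul a), integral_const,
          integral_const_mul a, probReal_univ, one_smul]
        gcongr
        refine hq.2.trans_eq ?_
        rw [integral_const_mul]

end PiSTOL

/-! ### Solving the self-bounding inequality and the final bound. -/

/-- For U ≤ T² the argument is at most (1 + w)(1 + T)³, so its logarithm is O(log(1 + T)). The outer
root is then dropped, since the upper bound is at least 1. -/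
theorem sqrt_log_le {w T U : ℝ} (hw : 0 ≤ w) (hT : 1 ≤ T) (hUT : U ≤ T ^ 2)
    {W : ℝ} (hW0 : 0 ≤ W) (hW : W ≤ w * (1 + T) * U) :
    Real.sqrt (4 * Real.log (1 + W)) ≤ (8 * w + 12) * Real.log (1 + T) := by
  have hlog2 := Real.log_two_gt_d9
  have hl2 : Real.log 2 ≤ Real.log (1 + T) := Real.log_le_log (by norm_num) (by linarith)
  set l := Real.log (1 + T) with hl
  have h1 : 1 + W ≤ (1 + w) * (1 + T) ^ 3 := by
    have : W ≤ w * (1 + T) * (1 + T) ^ 2 := hW.trans (by gcongr; nlinarith)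
    have : 1 ≤ (1 + T) ^ 3 := one_le_pow₀ (by linarith)
    nlinarith
  have h2 : Real.log (1 + W) ≤ (2 * w + 3) * l := by
    calc Real.log (1 + W) ≤ Real.log ((1 + w) * (1 + T) ^ 3) :=
          Real.log_le_log (by linarith) h1
      _ = Real.log (1 + w) + 3 * l := by
        rw [Real.log_mul (by positivity) (by positivity), Real.log_pow, ← hl]; norm_num
      _ ≤ w + 3 * l := by
        have := Real.log_le_sub_one_of_pos (show 0 < 1 + w by linarith)
        linarith
      _ ≤ _ := by nlinarith
  apply Real.sqrt_le_iff.2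
  constructor
  · nlinarith
  · have h3 : 1 ≤ (8 * w + 12) * l := by nlinarith
    have h4 := le_self_pow₀ h3 two_ne_zero
    linarith

theorem sqrt_add_sqrt_le {a L H T M : ℝ} (ha : 0 ≤ a) (hL : 0 ≤ L) (hH : 0 ≤ H) (hT : 0 ≤ T)
    (hM : 0 ≤ M) :
    Real.sqrt (a * L + a * Real.sqrt (4 * H * T * M)) ≤
      (Real.sqrt (a * L) + Real.sqrt (a * Real.sqrt (4 * H))) *
        (1 + T ^ (1 / 4 : ℝ) * M ^ (1 / 4 : ℝ)) := by
  have h1 : Real.sqrt (Real.sqrt (T * M)) = T ^ (1 / 4 : ℝ) * M ^ (1 / 4 : ℝ) := by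
    rw [← Real.mul_rpow hT hM, Real.sqrt_eq_rpow, Real.sqrt_eq_rpow, ← Real.rpow_mul (by positivity)]
    norm_num
  have h2 : Real.sqrt (a * L + a * Real.sqrt (4 * H * T * M)) ≤
      Real.sqrt (a * L) + Real.sqrt (a * Real.sqrt (4 * H * T * M)) := by
    apply Real.sqrt_le_iff.2
    refine ⟨by positivity, ?_⟩
    nlinarith [Real.sq_sqrt (show 0 ≤ a * L by positivity),
      Real.sq_sqrt (show 0 ≤ a * Real.sqrt (4 * H * T * M) by positivity),
      mul_nonneg (Real.sqrt_nonneg (a * L)) (Real.sqrt_nonneg (a * Real.sqrt (4 * H * T * M)))]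
  have h3 : Real.sqrt (a * Real.sqrt (4 * H * T * M)) =
      Real.sqrt (a * Real.sqrt (4 * H)) * (T ^ (1 / 4 : ℝ) * M ^ (1 / 4 : ℝ)) := by
    rw [← h1, ← Real.sqrt_mul (by positivity), mul_assoc a, ← Real.sqrt_mul (by positivity),
      ← mul_assoc (4 * H)]
  rw [h3] at h2
  refine h2.trans ?_
  have := Real.sqrt_nonneg (a * L)
  have := Real.sqrt_nonneg (a * Real.sqrt (4 * H))
  have h4 : 0 ≤ T ^ (1 / 4 : ℝ) * M ^ (1 / 4 : ℝ) := by positivity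
  nlinarith

/-- Solution of the self-bounding inequality for the expected cumulative loss. -/
theorem div_le_of_self_bounding {c l T U A M : ℝ} (hc : 1 ≤ c) (hl : 1 / 2 ≤ l) (hT : 1 ≤ T)
    (hU : 0 ≤ U) (hA : 0 ≤ A)
    (h : M ≤ A + c * l + c * l * U * (1 + T ^ (1 / 4 : ℝ) * M ^ (1 / 4 : ℝ))) :
    M / T ≤ A / T + (8 * c + 4 * c ^ 2) * l ^ 2 *
      (max (U ^ (4 / 3 : ℝ) * T ^ (-(2 / 3) : ℝ))
        (U * T ^ (-(3 / 4) : ℝ) * (A + 1) ^ (1 / 4 : ℝ)) + 1 / T) := by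
  -- S₁ and S₂ are T times the two terms of the maximum.
  have hT0 : 0 < T := by linarith
  set S₁ := U ^ (4 / 3 : ℝ) * T ^ (1 / 3 : ℝ) with hS₁
  set S₂ := U * T ^ (1 / 4 : ℝ) * (A + 1) ^ (1 / 4 : ℝ) with hS₂
  have hS₁0 : 0 ≤ S₁ := by positivity
  have hS₂0 : 0 ≤ S₂ := by positivity
  have e₁ : U ^ (4 / 3 : ℝ) * T ^ (-(2 / 3) : ℝ) = S₁ / T := by
    rw [hS₁, mul_div_assoc]
    congr 1
    rw [eq_div_iff hT0.ne', ← Real.rpow_add_one hT0.ne']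
    norm_num
  have e₂ : U * T ^ (-(3 / 4) : ℝ) * (A + 1) ^ (1 / 4 : ℝ) = S₂ / T := by
    rw [hS₂, eq_div_iff hT0.ne', mul_right_comm, mul_assoc U, ← Real.rpow_add_one hT0.ne']
    norm_num
  suffices hmain : M ≤ A + (8 * c + 4 * c ^ 2) * l ^ 2 * (max S₁ S₂ + 1) by
    rw [e₁, e₂, max_div_div_right hT0.le, ← add_div, ← mul_div_assoc, ← add_div]
    gcongr
  have hmax₁ := le_max_left S₁ S₂
  have hmax₂ := le_max_right S₁ S₂
  set S := max S₁ S₂ with hS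
  have hS0 : 0 ≤ S := hS₁0.trans hmax₁
  have hl2 : l ≤ 2 * l ^ 2 := by nlinarith
  rcases le_total M A with hMA | hMA
  · have : 0 ≤ (8 * c + 4 * c ^ 2) * l ^ 2 * (S + 1) := by positivity
    linarith
  have hT1 : 1 ≤ T ^ (1 / 4 : ℝ) := Real.one_le_rpow hT (by norm_num)
  have hA1 : 1 ≤ (A + 1) ^ (1 / 4 : ℝ) := Real.one_le_rpow (by linarith) (by norm_num)
  have hUS : U ≤ S := by
    refine le_trans ?_ hmax₂
    rw [hS₂, mul_assoc]
    exact le_mul_of_one_le_right hU (by nlinarith)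
  obtain ⟨Y, hY⟩ : ∃ Y, Y = M - A := ⟨_, rfl⟩
  have hY0 : 0 ≤ Y := by linarith
  have hsub : M ^ (1 / 4 : ℝ) ≤ A ^ (1 / 4 : ℝ) + Y ^ (1 / 4 : ℝ) := by
    have := Real.rpow_add_le_add_rpow hA hY0 (p := 1 / 4) (by norm_num) (by norm_num)
    rwa [show A + Y = M by linarith] at this
  have hUA : U * T ^ (1 / 4 : ℝ) * A ^ (1 / 4 : ℝ) ≤ S := by
    refine le_trans ?_ hmax₂
    rw [hS₂]
    gcongr
    linarith
  have hyoung : c * l * (U * T ^ (1 / 4 : ℝ)) * Y ^ (1 / 4 : ℝ) ≤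
      Y / 4 + 3 * (c ^ 2 * l ^ 2 * S) := by
    -- The extra factor 2 makes the base 2cl at least 1, so that its power 4/3 can be raised to the
    -- power 2.
    have h1 := Real.young_inequality_of_nonneg (a := Y ^ (1 / 4 : ℝ))
      (b := 2 * (c * l) * (U * T ^ (1 / 4 : ℝ))) (p := 4) (q := 4 / 3) (by positivity)
      (by positivity) ⟨by norm_num, by norm_num, by norm_num⟩
    rw [← Real.rpow_mul hY0, show (1 / 4 : ℝ) * 4 = 1 by norm_num, Real.rpow_one,
      Real.mul_rpow (by positivity) (by positivity), Real.mul_rpow hU (by positivity),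
      ← Real.rpow_mul hT0.le, show (1 / 4 : ℝ) * (4 / 3) = 1 / 3 by norm_num, ← hS₁] at h1
    have h2 : (2 * (c * l)) ^ (4 / 3 : ℝ) ≤ 4 * (c ^ 2 * l ^ 2) := by
      calc (2 * (c * l)) ^ (4 / 3 : ℝ) ≤ (2 * (c * l)) ^ (2 : ℝ) :=
            Real.rpow_le_rpow_of_exponent_le (by nlinarith) (by norm_num)
        _ = 4 * (c ^ 2 * l ^ 2) := by rw [Real.rpow_two]; ring
    have h3 : (2 * (c * l)) ^ (4 / 3 : ℝ) * S₁ ≤ 4 * (c ^ 2 * l ^ 2) * S := by gcongr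
    have h4 : 0 ≤ Y ^ (1 / 4 : ℝ) * (c * l * (U * T ^ (1 / 4 : ℝ))) := by positivity
    linarith
  have hcl : 0 ≤ c * l := by positivity
  have hYle : Y ≤ c * l + c * l * S + c * l * S + Y / 4 + 3 * (c ^ 2 * l ^ 2 * S) := by
    have h1 : c * l * U * (1 + T ^ (1 / 4 : ℝ) * M ^ (1 / 4 : ℝ)) ≤
        c * l * U * (1 + T ^ (1 / 4 : ℝ) * (A ^ (1 / 4 : ℝ) + Y ^ (1 / 4 : ℝ))) := by gcongr
    have h2 := mul_le_mul_of_nonneg_left hUS hcl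
    have h3 := mul_le_mul_of_nonneg_left hUA hcl
    linarith
  have hfin : c * l * (1 + 2 * S) ≤ c * (2 * l ^ 2) * (2 * (1 + S)) := by
    gcongr
    linarith
  have hcS : 0 ≤ c ^ 2 * l ^ 2 := by positivity
  have hcl2 : 0 ≤ c * l ^ 2 * (1 + S) := by positivity
  linarith

/-- The constant `C` depends only on the parameters `a, b, L, H`, and the degree `p` of the
logarithmic factor on nothing. -/
theorem corollary2 :
    ∃ p : ℕ, ∀ (a b : ℝ) (L H : ℝ≥0), 0 < a → 0 < b → 0 < L → 2.25 * (L : ℝ) ≤ a →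
      ∃ C : ℝ, 0 < C ∧
        ∀ (d : ℕ) (X : Set (EuclideanSpace ℝ (Fin d))), IsCompact X →
        ∀ (𝓗 : Type u) [NormedAddCommGroup 𝓗] [InnerProductSpace ℝ 𝓗] [CompleteSpace 𝓗]
          [RKHS ℝ 𝓗 X ℝ],
        Continuous (fun q : X × X => reproKernel 𝓗 q.1 q.2) →
        ∀ (ρ : Measure (X × Set.Icc (-1 : ℝ) 1)) [IsProbabilityMeasure ρ],
        (∀ᵐ z ∂ρ, ‖kernelSection 𝓗 z.1‖ ≤ 1) →
        ∀ ℓ : ℝ → ℝ, IsSmoothLoss L H ℓ →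
        ∀ T : ℕ, 1 ≤ T →
        ∀ (Ω : Type v) [MeasurableSpace Ω] (P : Measure Ω) [IsProbabilityMeasure P]
          (x : ℕ → Ω → X) (y : ℕ → Ω → Set.Icc (-1 : ℝ) 1) (s : ℕ → Ω → ℝ),
        (∀ t < T, Measurable (fun ω => (x t ω, y t ω)) ∧
          P.map (fun ω => (x t ω, y t ω)) = ρ) →
        iIndepFun (fun (t : Fin T) ω => (x t ω, y t ω)) P →
        (∀ ω, PiSTOL.IsRun 𝓗 a b L (fun t r => ℓ ((y t ω : ℝ) * r))
          (fun t => x t ω) (fun t => s t ω) T) →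
        Integrable (fun ω => lossRisk ρ ℓ
          (PiSTOL.average 𝓗 a b L (fun t => x t ω) (fun t => s t ω) T)) P ∧
        ∫ ω, lossRisk ρ ℓ
          (PiSTOL.average 𝓗 a b L (fun t => x t ω) (fun t => s t ω) T) ∂P ≤
        ⨅ h : 𝓗, (lossRisk ρ ℓ h + C * Real.log (1 + T) ^ p *
          (max (‖h‖ ^ (4 / 3 : ℝ) * (T : ℝ) ^ (-(2 / 3) : ℝ))
              (‖h‖ * (T : ℝ) ^ (-(3 / 4) : ℝ) * (T * lossRisk ρ ℓ h + 1) ^ (1 / 4 : ℝ))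
            + 1 / T)) := by
  -- The exponent 2 is the rounded-up 4/3 left by Young's inequality.
  refine ⟨2, fun a b L H ha hb hL haL => ?_⟩
  have hL' : (0 : ℝ) < L := hL
  obtain ⟨w, hw⟩ : ∃ w, w = (1 + a * L) / b := ⟨_, rfl⟩
  have hw0 : 0 < w := by rw [hw]; positivity
  obtain ⟨r, hr⟩ : ∃ r, r = Real.sqrt (a * L) + Real.sqrt (a * Real.sqrt (4 * H)) := ⟨_, rfl⟩
  have hr0 : 0 ≤ r := by rw [hr]; positivity
  -- The 1 ensures c ≥ 1; 2b absorbs b through b ≤ 2bl, as l ≥ 1/2; the last term is the product of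
  -- the constants of `sqrt_log_le` and `sqrt_add_sqrt_le`.
  obtain ⟨c, hcdef⟩ : ∃ c, c = 1 + (2 * b + 24 * Real.exp 8 * b) + (8 * w + 12) * r := ⟨_, rfl⟩
  have hc₂ : 2 * b + 24 * Real.exp 8 * b ≤ c := by
    rw [hcdef]; linarith [show 0 ≤ (8 * w + 12) * r by positivity]
  have hc₃ : (8 * w + 12) * r ≤ c := by
    rw [hcdef]; linarith [show 0 ≤ 2 * b + 24 * Real.exp 8 * b by positivity]
  have hc₁ : 1 ≤ c := by
    rw [hcdef]
    linarith [show 0 ≤ 2 * b + 24 * Real.exp 8 * b by positivity,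
      show 0 ≤ (8 * w + 12) * r by positivity]
  -- The summand 4L pays for the competitors with ‖h‖ > T².
  refine ⟨8 * c + 4 * c ^ 2 + 4 * L, by positivity, ?_⟩
  intro d X _ 𝓗 _ _ _ _ hK ρ _ hρ ℓ hℓ T hT Ω _ P _ x y s hz hind hrun
  have hk := continuous_kernelSection hK
  obtain ⟨hint, M, hM0, hMT, hM⟩ :=
    PiSTOL.exists_expected_loss hℓ hk hρ hb hL haL hT hz hind hrun
  refine ⟨hint, le_ciInf fun h => hMT.trans ?_⟩
  have hT' : (1 : ℝ) ≤ T := by exact_mod_cast hT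
  have hT0 : (0 : ℝ) < T := by linarith
  have hl : 1 / 2 ≤ Real.log (1 + T) := by
    have h1 := Real.log_two_gt_d9
    have h2 : Real.log 2 ≤ Real.log (1 + T) := Real.log_le_log (by norm_num) (by linarith)
    linarith
  set l := Real.log (1 + T) with hl_def
  have hbl : b + 24 * Real.exp 8 * b * l ≤ c * l := by
    have : b ≤ 2 * b * l := by nlinarith
    nlinarith
  have hR0 : 0 ≤ lossRisk ρ ℓ h := lossRisk_nonneg hℓ _
  set R := lossRisk ρ ℓ h with hR
  set U := ‖h‖ with hU
  have hU0 : 0 ≤ U := norm_nonneg h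
  have hmax : 0 ≤ max (U ^ (4 / 3 : ℝ) * (T : ℝ) ^ (-(2 / 3) : ℝ))
      (U * (T : ℝ) ^ (-(3 / 4) : ℝ) * (T * R + 1) ^ (1 / 4 : ℝ)) :=
    le_max_of_le_left (by positivity)
  rcases le_total U ((T : ℝ) ^ 2) with hUT | hUT
  · have hlog : Real.sqrt (4 * Real.log (1 + Real.sqrt (a * L * (1 + T)) * U / b)) ≤
        (8 * w + 12) * l := by
      refine sqrt_log_le hw0.le hT' hUT (by positivity) ?_
      have : Real.sqrt (a * L * (1 + T)) ≤ (1 + a * L) * (1 + T) := by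
        apply Real.sqrt_le_iff.2
        refine ⟨by positivity, ?_⟩
        have h1 : 0 < a * L := by positivity
        have : a * L * (1 + T) ≤ (1 + a * L) * (1 + T) := by gcongr; linarith
        have : 1 ≤ (1 + a * L) * (1 + T) := by nlinarith
        nlinarith
      calc Real.sqrt (a * L * (1 + T)) * U / b ≤ (1 + a * L) * (1 + T) * U / b := by gcongr
        _ = w * (1 + T) * U := by rw [hw]; ring
    have hrad := sqrt_add_sqrt_le (a := a) (L := L) (H := H) (T := T) (M := M) ha.le hL'.le
      H.coe_nonneg hT0.le hM0
    rw [← hr] at hrad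
    have hself : M ≤ T * R + c * l +
        c * l * U * (1 + (T : ℝ) ^ (1 / 4 : ℝ) * M ^ (1 / 4 : ℝ)) := by
      have h1 : U * Real.sqrt (4 * Real.log (1 + Real.sqrt (a * L * (1 + T)) * U / b)) *
          Real.sqrt (a * L + a * Real.sqrt (4 * H * T * M)) ≤
          U * ((8 * w + 12) * l) * (r * (1 + (T : ℝ) ^ (1 / 4 : ℝ) * M ^ (1 / 4 : ℝ))) := by
        gcongr
      have h2 : ((8 * w + 12) * r) * (l * U * (1 + (T : ℝ) ^ (1 / 4 : ℝ) * M ^ (1 / 4 : ℝ))) ≤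
          c * (l * U * (1 + (T : ℝ) ^ (1 / 4 : ℝ) * M ^ (1 / 4 : ℝ))) := by
        gcongr
      linarith [hM h]
    refine (div_le_of_self_bounding hc₁ hl hT' hU0 (by positivity) hself).trans ?_
    rw [mul_div_cancel_left₀ _ hT0.ne']
    gcongr ?_ + ?_ * _ * _
    · exact le_rfl
    · linarith
  -- With competitor 0 the logarithm of the norm disappears. The price L‖h‖ fits because U ≥ T² is
  -- the same as U ≤ U^{4/3} T^{-2/3}.
  · have h0 := hM 0
    rw [norm_zero, zero_mul, zero_mul, add_zero] at h0
    have h1 := lossRisk_sub_le (𝓗 := 𝓗) hℓ hk.stronglyMeasurable hρ 0 h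
    rw [zero_sub, norm_neg, ← hU, ← hR] at h1
    have h2 : U ≤ U ^ (4 / 3 : ℝ) * (T : ℝ) ^ (-(2 / 3) : ℝ) := by
      have hUpos : 0 < U := lt_of_lt_of_le (by positivity) hUT
      have e1 : (T : ℝ) ^ (2 / 3 : ℝ) ≤ U ^ (1 / 3 : ℝ) := by
        calc (T : ℝ) ^ (2 / 3 : ℝ) = ((T : ℝ) ^ 2) ^ (1 / 3 : ℝ) := by
              rw [← Real.rpow_two, ← Real.rpow_mul hT0.le]; norm_num
          _ ≤ U ^ (1 / 3 : ℝ) := by gcongr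
      rw [Real.rpow_neg hT0.le, ← div_eq_mul_inv, le_div_iff₀ (by positivity)]
      calc U * (T : ℝ) ^ (2 / 3 : ℝ) ≤ U * U ^ (1 / 3 : ℝ) := by gcongr
        _ = U ^ (4 / 3 : ℝ) := by
          rw [mul_comm, ← Real.rpow_add_one hUpos.ne']; norm_num
    have h3 := h2.trans (le_max_left _ (U * (T : ℝ) ^ (-(3 / 4) : ℝ) *
      (T * R + 1) ^ (1 / 4 : ℝ)))
    set S := max (U ^ (4 / 3 : ℝ) * (T : ℝ) ^ (-(2 / 3) : ℝ))
      (U * (T : ℝ) ^ (-(3 / 4) : ℝ) * (T * R + 1) ^ (1 / 4 : ℝ)) with hS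
    have hl2 : l ≤ 2 * l ^ 2 := by nlinarith
    have hl4 : 1 ≤ 4 * l ^ 2 := by nlinarith
    have h4 : M / T ≤ R + L * U + c * l * (1 / T) := by
      rw [div_le_iff₀ hT0]
      have e : (R + L * U + c * l * (1 / T)) * T = T * (R + L * U) + c * l := by
        field_simp
      rw [e]
      have := mul_le_mul_of_nonneg_left (sub_le_iff_le_add'.1 h1) hT0.le
      linarith
    have h5 : L * U ≤ 4 * L * l ^ 2 * S := by
      calc (L : ℝ) * U = L * 1 * U := by ring
        _ ≤ L * (4 * l ^ 2) * S := by gcongr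
        _ = _ := by ring
    have h6 : c * l * (1 / T) ≤ 8 * c * l ^ 2 * (1 / T) := by
      have : c * l ≤ 8 * c * l ^ 2 := by
        have := mul_le_mul_of_nonneg_left hl2 (zero_le_one.trans hc₁)
        have := mul_nonneg (zero_le_one.trans hc₁) (sq_nonneg l)
        linarith
      gcongr
    have hTi : 0 < 1 / (T : ℝ) := by positivity
    have h7 : 0 ≤ (8 * c + 4 * c ^ 2) * l ^ 2 * S := by positivity
    have h8 : 0 ≤ (4 * c ^ 2 + 4 * L) * l ^ 2 * (1 / T) := by positivity
    linarith
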